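/- Let $m_1,m_2\ge 1$ be real, $\rho(z)=|z_1|^{2m_1}+|z_2|^{2m_2}$ and $\mathcal E=\{z\in\mathbb C^2:\rho(z)<1\}$. Let $dS$ be the positive measure on $\partial\mathcal E$ defined by the form $\partial\rho\wedge\bar\partial\partial\rho$ (i.e. the absolute value of its restriction to $\partial\mathcal E$). For $f\in L^1(\partial\mathcal E,dS)$ and $z\in\mathcal E$ let $$Kf(z)=\frac1{(2\pi i)^2}\int_{\partial\mathcal E}\frac{f(\xi)\,dS(\xi)}{w(\xi,z)^2},\qquad w(\xi,z)=\sum_{j=1}^2 m_j|\xi_j|^{2(m_j-1)}\bar\xi_j(\xi_j-z_j),$$ and on $\partial\mathcal E$ let $Kf(z)=\lim_{r\to1-}Kf(rz)$ where this limit exists $dS$-almost everywhere. For measurable $p:\partial\mathcal E\to(1,\infty)$ let $L^{p(\cdot)}(\partial\mathcal E)$ be the space of all $f\in L^1(\partial\mathcal E,dS)$ with $\int_{\partial\mathcal E}|tf|^{p}\,dS<\infty$ for some $t>0$, with the Luxemburg norm $\|f\|=\inf\{t>0:\int_{\partial\mathcal E}|f/t|^{p}\,dS\le1\}$. Write $\xi_j=r_je^{i\theta_j}$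 with $\theta_j\in(-\pi,\pi]$ (and $\theta_j=0$ if $\xi_j=0$). For $\alpha>0$ and $0<\gamma_1<\gamma_2$ put $$W_\alpha=\Big\{\xi\in\partial\mathcal E:\ -\tfrac{\pi}{12}\le\theta_1\le0,\ -2\alpha\le\theta_2\le-\alpha,\ \gamma_1\alpha\le r_1^{2m_1}\le\gamma_2\alpha\Big\}.$$ **Theorem.** There are $0<\gamma_1<\gamma_2$ such that the following holds for every $p_0>1$ and every continuous $\psi:[-\pi,\pi]\to(1-p_0,\infty)$ such that $\psi(0)=0$, $\lim_{\alpha\to0+}\psi(\alpha)\ln\frac1\alpha=+\infty$ and, for some $\delta\in(0,\pi]$, $\psi$ is nondecreasing on $[0,\delta]$ and negative on $[-\delta,0)$. Put $p(\xi)=p_0+\psi(\theta_2)$. 1. There is $\alpha_0>0$ such that there are sequences $(\alpha_k)_{k\ge1}$ in $(0,\alpha_0)$ with $$2\alpha_{k+1}\le\alpha_k,\qquad \Big(\frac1{\alpha_k}\Big)^{\frac1{p_0+\psi(\alpha_k)}-\frac1{p_0}}\le2^{-k/p_0}\qquad(k\ge1),$$ and for every such sequence the function $h=\sum_{k\ge1}\lambda_k\chi_{W_{\alpha_k}}$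 with $\lambda_k=\alpha_k^{-2/(p_0+\psi(\alpha_k))}$ belongs to $L^{p(\cdot)}(\partial\mathcal E)$, while its image $Kh$ exists $dS$-almost everywhere on $\partial\mathcal E$ and does not belong to $L^{p(\cdot)}(\partial\mathcal E)$; in fact $\int_{\partial\mathcal E}|tKh|^{p}\,dS=\infty$ for every $t>0$. 2. $K$ is not bounded on $L^{p(\cdot)}(\partial\mathcal E)$: there is no constant $C$ such that, for every $f\in L^{p(\cdot)}(\partial\mathcal E)$ for which $Kf$ exists $dS$-almost everywhere on $\partial\mathcal E$, one has $Kf\in L^{p(\cdot)}(\partial\mathcal E)$ and $\|Kf\|\le C\|f\|$. 3. Call a function $u$ on a set $X$ with distance $d$ log-Hölder near $x\in X$ if there are $C$ and a neighbourhood $U$ of $x$ in $X$ with $|u(y)-u(y')|\le C/|\log d(y,y')|$ for all distinct $y,y'\in U$ (use the Euclidean distance on $\partial\mathcal E$ and on $[-\pi,\pi]$). Then $p$ is not log-Hölder near any $\xi\in\partial\mathcal E$ with $\xi_2\ne0$ and $\theta_2=0$. If moreover $\psi(-\pi)=\psi(\pi)$ and $\psi$ is log-Hölder near every point of $[-\pi,\pi]\setminus\{0\}$,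 then $p$ is log-Hölder near every $\xi\in\partial\mathcal E$ with $\xi_2\neq0$ and $\theta_2\neq0$. -/

import Mathlib

open Real Set Filter Topology MeasureTheory

noncomputable section

namespace CLF

/-- The boundary of the complex ellipsoid `|z₁|^(2m₁) + |z₂|^(2m₂) < 1` in `ℂ²`. -/
def bdry (m₁ m₂ : ℝ) : Set (ℂ × ℂ) :=
  {ξ | ‖ξ.1‖ ^ (2 * m₁) + ‖ξ.2‖ ^ (2 * m₂) = 1}

/-- The `(1,0)`-form `∂ρ` at `ξ`, `ρ(ξ) = |ξ₁|^(2m₁) + |ξ₂|^(2m₂)`, evaluated at the vector `X`. -/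
def dRho (m₁ m₂ : ℝ) (ξ X : ℂ × ℂ) : ℂ :=
  ((m₁ * ‖ξ.1‖ ^ (2 * (m₁ - 1)) : ℝ) : ℂ) * star ξ.1 * X.1
    + ((m₂ * ‖ξ.2‖ ^ (2 * (m₂ - 1)) : ℝ) : ℂ) * star ξ.2 * X.2

/-- The 2-form `∂̄∂ρ = ∑ⱼ mⱼ² |ξⱼ|^(2(mⱼ-1)) dξ̄ⱼ ∧ dξⱼ` at `ξ`, evaluated at `X, Y`. -/
def ddRho (m₁ m₂ : ℝ) (ξ X Y : ℂ × ℂ) : ℂ :=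
  ((m₁ ^ 2 * ‖ξ.1‖ ^ (2 * (m₁ - 1)) : ℝ) : ℂ) * (star X.1 * Y.1 - star Y.1 * X.1)
    + ((m₂ ^ 2 * ‖ξ.2‖ ^ (2 * (m₂ - 1)) : ℝ) : ℂ) * (star X.2 * Y.2 - star Y.2 * X.2)

/-- The 3-form `∂ρ ∧ ∂̄∂ρ` at `ξ`, evaluated at `X, Y, Z`. -/
def lerayForm (m₁ m₂ : ℝ) (ξ X Y Z : ℂ × ℂ) : ℂ :=
  dRho m₁ m₂ ξ X * ddRho m₁ m₂ ξ Y Z - dRho m₁ m₂ ξ Y * ddRho m₁ m₂ ξ X Z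
    + dRho m₁ m₂ ξ Z * ddRho m₁ m₂ ξ X Y

/-- Polar parametrization `(r₁, θ₁, θ₂) ↦ (r₁ e^{iθ₁}, r₂(r₁) e^{iθ₂})` of the boundary,
where `r₂(r₁) = (1 - r₁^(2m₁))^(1/(2m₂))`. -/
def param (m₁ m₂ : ℝ) (t : ℝ × ℝ × ℝ) : ℂ × ℂ :=
  ((t.1 : ℂ) * Complex.exp (t.2.1 * Complex.I),
    (((1 - t.1 ^ (2 * m₁)) ^ (1 / (2 * m₂)) : ℝ) : ℂ) * Complex.exp (t.2.2 * Complex.I))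

/-- Parameter domain; on it `param` is a bijection onto the boundary without
the two circles `ξ₁ = 0` and `ξ₂ = 0`. -/
def paramDomain : Set (ℝ × ℝ × ℝ) :=
  Ioo (0 : ℝ) 1 ×ˢ Ioc (-π) π ×ˢ Ioc (-π) π

/-- Density of the pull-back of `∂ρ ∧ ∂̄∂ρ` to the parameter domain. -/
def lerayDensity (m₁ m₂ : ℝ) (t : ℝ × ℝ × ℝ) : ℝ :=
  ‖lerayForm m₁ m₂ (param m₁ m₂ t)
    (deriv (fun r : ℝ => param m₁ m₂ (r, t.2.1, t.2.2)) t.1)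
    (deriv (fun θ : ℝ => param m₁ m₂ (t.1, θ, t.2.2)) t.2.1)
    (deriv (fun θ : ℝ => param m₁ m₂ (t.1, t.2.1, θ)) t.2.2)‖

/-- The positive measure `dS` on the boundary defined by the form `∂ρ ∧ ∂̄∂ρ`. -/
def lerayMeasure (m₁ m₂ : ℝ) : Measure (ℂ × ℂ) :=
  Measure.map (param m₁ m₂)
    ((volume.restrict paramDomain).withDensity
      (fun t => ENNReal.ofReal (lerayDensity m₁ m₂ t)))

/-- `w(ξ,z) = ⟨∂ρ(ξ), ξ - z⟩`. -/
def w (m₁ m₂ : ℝ) (ξ z : ℂ × ℂ) : ℂ := dRho m₁ m₂ ξ (ξ - z)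

/-- The Cauchy–Leray–Fantappiè integral of `f` at an interior point `z`. -/
def cauchyLF (m₁ m₂ : ℝ) (f : ℂ × ℂ → ℂ) (z : ℂ × ℂ) : ℂ :=
  1 / (2 * (π : ℂ) * Complex.I) ^ 2 * ∫ ξ, f ξ / (w m₁ m₂ ξ z) ^ 2 ∂(lerayMeasure m₁ m₂)

/-- `g = Kf` on the boundary: the interior function `Kf` has radial limit `g` at almost
every boundary point. -/
def IsImage (m₁ m₂ : ℝ) (f g : ℂ × ℂ → ℂ) : Prop :=
  ∀ᵐ z ∂(lerayMeasure m₁ m₂),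
    Tendsto (fun r : ℝ => cauchyLF m₁ m₂ f (r • z)) (𝓝[<] 1) (𝓝 (g z))

/-- The modular `∫ |f|^{p(ξ)} dS`. -/
def modular (m₁ m₂ : ℝ) (p : ℂ × ℂ → ℝ) (f : ℂ × ℂ → ℂ) : ENNReal :=
  ∫⁻ ξ, ENNReal.ofReal (‖f ξ‖ ^ p ξ) ∂(lerayMeasure m₁ m₂)

/-- `f ∈ L^{p(·)}`. -/
def MemLpVar (m₁ m₂ : ℝ) (p : ℂ × ℂ → ℝ) (f : ℂ × ℂ → ℂ) : Prop :=
  Integrable f (lerayMeasure m₁ m₂) ∧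
    ∃ t : ℝ, 0 < t ∧ modular m₁ m₂ p (fun ξ => (t : ℂ) * f ξ) < ⊤

/-- The Luxemburg norm. -/
def luxNorm (m₁ m₂ : ℝ) (p : ℂ × ℂ → ℝ) (f : ℂ × ℂ → ℂ) : ℝ :=
  sInf {t : ℝ | 0 < t ∧ modular m₁ m₂ p (fun ξ => f ξ / (t : ℂ)) ≤ 1}

/-- `K` is bounded on `L^{p(·)}`: every image `g = Kf` of `f ∈ L^{p(·)}` lies in `L^{p(·)}`,
with `‖Kf‖ ≤ C ‖f‖`. -/
def BoundedOnLpVar (m₁ m₂ : ℝ) (p : ℂ × ℂ → ℝ) : Prop :=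
  ∃ C : ℝ, ∀ f g : ℂ × ℂ → ℂ, MemLpVar m₁ m₂ p f → IsImage m₁ m₂ f g →
    MemLpVar m₁ m₂ p g ∧ luxNorm m₁ m₂ p g ≤ C * luxNorm m₁ m₂ p f

/-- Euclidean distance in `ℂ²` (the norm of the product type is the maximum norm). -/
def edist₂ (z z' : ℂ × ℂ) : ℝ := √(‖z.1 - z'.1‖ ^ 2 + ‖z.2 - z'.2‖ ^ 2)

/-- The log-Hölder condition for `p` on the boundary, near the boundary point `ξ`. -/
def LogHolderNear (m₁ m₂ : ℝ) (p : ℂ × ℂ → ℝ) (ξ : ℂ × ℂ) : Prop :=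
  ∃ C δ : ℝ, 0 < δ ∧ ∀ z ∈ bdry m₁ m₂, ∀ z' ∈ bdry m₁ m₂,
    edist₂ z ξ < δ → edist₂ z' ξ < δ → |p z - p z'| ≤ C / |Real.log (edist₂ z z')|

/-- The log-Hölder condition for `ψ` on `[-π, π]`, near `s`. -/
def LogHolderNearReal (ψ : ℝ → ℝ) (s : ℝ) : Prop :=
  ∃ C δ : ℝ, 0 < δ ∧ ∀ t ∈ Icc (-π) π, ∀ t' ∈ Icc (-π) π,
    |t - s| < δ → |t' - s| < δ → |ψ t - ψ t'| ≤ C / abs (Real.log (abs (t - t')))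

/-- The exponent `p(ξ) = p₀ + ψ(θ₂)`, where `θ₂ ∈ (-π, π]` is the argument of `ξ₂`. -/
def exponent (p₀ : ℝ) (ψ : ℝ → ℝ) (ξ : ℂ × ℂ) : ℝ := p₀ + ψ (Complex.arg ξ.2)

/-- The assumptions on `p₀` and `ψ : [-π, π] → (1 - p₀, ∞)`. -/
structure Profile (p₀ : ℝ) (ψ : ℝ → ℝ) : Prop where
  one_lt : 1 < p₀
  cont : ContinuousOn ψ (Icc (-π) π)
  lower : ∀ t ∈ Icc (-π) π, 1 - p₀ < ψ t
  zero : ψ 0 = 0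
  near : ∃ δ : ℝ, 0 < δ ∧ δ ≤ π ∧ MonotoneOn ψ (Icc 0 δ) ∧ ∀ t ∈ Ico (-δ) 0, ψ t < 0
  lim : Tendsto (fun t : ℝ => ψ t * Real.log (1 / t)) (𝓝[>] 0) atTop

/-- The boundary patch `W_α`. -/
def patch (m₁ m₂ γ₁ γ₂ α : ℝ) : Set (ℂ × ℂ) :=
  {ξ | ξ ∈ bdry m₁ m₂ ∧ Complex.arg ξ.1 ∈ Icc (-(π / 12)) 0 ∧
    Complex.arg ξ.2 ∈ Icc (-2 * α) (-α) ∧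
    γ₁ * α ≤ ‖ξ.1‖ ^ (2 * m₁) ∧ ‖ξ.1‖ ^ (2 * m₁) ≤ γ₂ * α}

/-- Admissible sequences `α₁, α₂, …` in `(0, α₀)`; here `a k` stands for `α_{k+1}`. -/
structure Admissible (p₀ : ℝ) (ψ : ℝ → ℝ) (α₀ : ℝ) (a : ℕ → ℝ) : Prop where
  pos : ∀ k, 0 < a k
  lt : ∀ k, a k < α₀
  halving : ∀ k, 2 * a (k + 1) ≤ a k
  decay : ∀ k : ℕ, (1 / a k) ^ (1 / (p₀ + ψ (a k)) - 1 / p₀) ≤ (2 : ℝ) ^ (-((k : ℝ) + 1) / p₀)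

/-- `λ = α ^ (-2 / (p₀ + ψ(α)))`. -/
def coeff (p₀ : ℝ) (ψ : ℝ → ℝ) (α : ℝ) : ℝ := α ^ (-2 / (p₀ + ψ α))

/-- `h = ∑ₖ λₖ χ_{W_{αₖ}}`. -/
def testFun (m₁ m₂ γ₁ γ₂ p₀ : ℝ) (ψ : ℝ → ℝ) (a : ℕ → ℝ) (ξ : ℂ × ℂ) : ℂ :=
  ∑' k : ℕ, (patch m₁ m₂ γ₁ γ₂ (a k)).indicator (fun _ => (coeff p₀ ψ (a k) : ℂ)) ξ

end CLF

end

noncomputable section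

namespace CLF

/-! Unboundedness. Write `W` for a patch at scale `α` (`θ₂` slightly negative) and `W'` for its
opposite patch (`θ₂` slightly positive). For `ξ ∈ W` and `z ∈ W'`, `w ξ z` is nearly `-i m₂ (θ₂(z) -
θ₂(ξ))`, because the first coordinate and the real part are small in comparison. Hence `1/w²` has
negative real part of size at least a constant times `α⁻²` (`w_bounds`, `le_neg_one_div_sq_re`).
Since `dS(W)` is a multiple of `α²`, `K` carries `λ χ_W` to something of size at least `cλ` on `W'`,
and the other patches contribute with the same sign, so nothing cancels
(`le_norm_cauchyLF_testFun`). On `W'` the exponent is at least `p₀ + ψ(α)`, and `λ ^ (p₀ + ψ(α)) =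
α⁻²`, so every `W'` adds at least a fixed amount to the modular of `Kh`, which is therefore infinite
(`modular_image_eq_top`). On `W` the exponent is below `p₀`, and the decay condition makes `λ ^ p₀
α²` summable, so `h` lies in the space (`memLpVar_testFun`). The condition `ψ(α) ln(1/α) → ∞` is
what makes such scales available (`tendsto_decay`).

Existence of `Kh`. Off a null set `h` is locally constant on the boundary. Near such a point split
`h = (h - c) + c`. The first part vanishes near the point, away from which `w` is bounded below by
strict convexity and compactness, so dominated convergence applies
(`tendsto_cauchyLF_of_eventually_eq_zero`). The image of a constant is constant inside the domain,
by the mean value property in both angles (`cauchyLF_const`).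

Log-Hölder condition. Rotating `ξ₂` by a small angle tests the failure at `θ₂ = 0`. Elsewhere the
argument is Lipschitz modulo `2π`, a Lipschitz change costs only a factor in the logarithmic
modulus, and `ψ(-π) = ψ(π)` closes the gap at the branch cut. -/

/-! ### Convexity of the ellipsoid and lower bounds for `w` -/

lemma rpow_two_mul_sub_one_mul_sq {m a : ℝ} (hm : 1 ≤ m) (ha : 0 ≤ a) :
    a ^ (2 * (m - 1)) * a ^ 2 = a ^ (2 * m) := by
  rcases ha.eq_or_lt with rfl | ha
  · rw [zero_rpow (by linarith : 2 * m ≠ 0)]; simp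
  · rw [← rpow_natCast a 2, ← rpow_add ha]; congr 1; push_cast; ring

/-- Weighted arithmetic-geometric mean inequality, in strict form. -/
lemma two_mul_rpow_mul_lt {m a b : ℝ} (hm : 1 ≤ m) (ha : 0 ≤ a) (hb : 0 ≤ b) (hab : a ≠ b) :
    2 * m * (a ^ (2 * (m - 1)) * a * b) < (2 * m - 1) * a ^ (2 * m) + b ^ (2 * m) := by
  rcases ha.eq_or_lt with rfl | ha
  · have : 0 < b ^ (2 * m) := rpow_pos_of_pos (lt_of_le_of_ne hb hab) _
    rw [zero_rpow (by linarith : 2 * m ≠ 0)]; simpa using this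
  · have h := one_add_mul_self_lt_rpow_one_add (s := b / a - 1) (p := 2 * m)
      (by linarith [div_nonneg hb ha.le])
      (by rw [sub_ne_zero, ne_eq, div_eq_one_iff_eq ha.ne']; exact hab.symm) (by linarith)
    rw [add_sub_cancel, div_rpow hb ha.le, lt_div_iff₀ (rpow_pos_of_pos ha _)] at h
    have h2 := rpow_two_mul_sub_one_mul_sq hm ha.le
    have h3 : b / a * a ^ (2 * m) = a ^ (2 * (m - 1)) * a * b := by
      rw [← h2]; field_simp
    nlinarith

/-- One summand of `w`. -/
def wCoord (m : ℝ) (ξ z : ℂ) : ℂ := ((m * ‖ξ‖ ^ (2 * (m - 1)) : ℝ) : ℂ) * star ξ * (ξ - z)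

lemma w_eq (m₁ m₂ : ℝ) (ξ z : ℂ × ℂ) :
    w m₁ m₂ ξ z = wCoord m₁ ξ.1 z.1 + wCoord m₂ ξ.2 z.2 := rfl

lemma star_mul_re_le (ξ z : ℂ) : (star ξ * z).re ≤ ‖ξ‖ * ‖z‖ := by
  have := Complex.re_le_norm (star ξ * z)
  rwa [norm_mul, norm_star] at this

lemma wCoord_eq {m : ℝ} (hm : 1 ≤ m) (ξ z : ℂ) :
    wCoord m ξ z = ((m * ‖ξ‖ ^ (2 * m) : ℝ) : ℂ)
      - ((m * ‖ξ‖ ^ (2 * (m - 1)) : ℝ) : ℂ) * (star ξ * z) := by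
  have : star ξ * ξ = ((‖ξ‖ ^ 2 : ℝ) : ℂ) := by
    rw [mul_comm]; simpa using Complex.mul_conj' ξ
  rw [wCoord, ← rpow_two_mul_sub_one_mul_sq hm (norm_nonneg ξ), mul_assoc, mul_sub, mul_sub, this]
  push_cast; ring

lemma wCoord_re {m : ℝ} (hm : 1 ≤ m) (ξ z : ℂ) :
    (wCoord m ξ z).re = m * ‖ξ‖ ^ (2 * m) - m * ‖ξ‖ ^ (2 * (m - 1)) * (star ξ * z).re := by
  rw [wCoord_eq hm, Complex.sub_re, Complex.re_ofReal_mul, Complex.ofReal_re]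

lemma wCoord_im {m : ℝ} (hm : 1 ≤ m) (ξ z : ℂ) :
    (wCoord m ξ z).im = - (m * ‖ξ‖ ^ (2 * (m - 1)) * (star ξ * z).im) := by
  rw [wCoord_eq hm, Complex.sub_im, Complex.im_ofReal_mul, Complex.ofReal_im, zero_sub]

/-- Strict convexity of `|z|^(2m)`: the graph lies above its tangent plane at `ξ`. If the moduli
differ, the weighted mean inequality is strict; if they agree, strictness comes from `Re(ξ̄ z) <
|ξ|²`. -/
lemma lt_wCoord_re {m : ℝ} (hm : 1 ≤ m) {ξ z : ℂ} (h : z ≠ ξ) :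
    (‖ξ‖ ^ (2 * m) - ‖z‖ ^ (2 * m)) / 2 < (wCoord m ξ z).re := by
  rw [wCoord_re hm]
  have hp : 0 ≤ m * ‖ξ‖ ^ (2 * (m - 1)) := by positivity
  by_cases hn : ‖ξ‖ = ‖z‖
  · have hξ : 0 < ‖ξ‖ := by
      rcases (norm_nonneg ξ).eq_or_lt with h0 | h0
      · exact absurd ((norm_eq_zero.1 (hn.symm.trans h0.symm)).trans (norm_eq_zero.1 h0.symm).symm) h
      · exact h0
    have h1 : (star ξ * z).re < ‖ξ‖ ^ 2 := by
      have h2 : 0 < ‖ξ - z‖ ^ 2 := by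
        have := norm_pos_iff.2 (sub_ne_zero.2 h.symm); positivity
      have h3 : ‖ξ - z‖ ^ 2 = ‖ξ‖ ^ 2 + ‖z‖ ^ 2 - 2 * (star ξ * z).re := by
        simp only [← Complex.normSq_eq_norm_sq, Complex.normSq_apply, Complex.sub_re,
          Complex.sub_im, Complex.mul_re, Complex.star_def, Complex.conj_re, Complex.conj_im]
        ring
      rw [← hn] at h3
      linarith
    have h4 : 0 < m * ‖ξ‖ ^ (2 * (m - 1)) := by positivity
    have h5 := mul_lt_mul_of_pos_left h1 h4
    rw [mul_assoc, mul_assoc, rpow_two_mul_sub_one_mul_sq hm hξ.le, ← mul_assoc] at h5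
    rw [← hn]; linarith
  · have h1 := two_mul_rpow_mul_lt hm (norm_nonneg ξ) (norm_nonneg z) hn
    have h2 := mul_le_mul_of_nonneg_left (star_mul_re_le ξ z) hp
    nlinarith

lemma le_wCoord_re {m : ℝ} (hm : 1 ≤ m) (ξ z : ℂ) :
    (‖ξ‖ ^ (2 * m) - ‖z‖ ^ (2 * m)) / 2 ≤ (wCoord m ξ z).re := by
  by_cases h : z = ξ
  · simp [h, wCoord]
  · exact (lt_wCoord_re hm h).le

/-- The defining function of the ellipsoid. -/
def rho (m₁ m₂ : ℝ) (z : ℂ × ℂ) : ℝ := ‖z.1‖ ^ (2 * m₁) + ‖z.2‖ ^ (2 * m₂)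

lemma le_w_re {m₁ m₂ : ℝ} (hm₁ : 1 ≤ m₁) (hm₂ : 1 ≤ m₂) {ξ : ℂ × ℂ} (hξ : ξ ∈ bdry m₁ m₂)
    (z : ℂ × ℂ) : (1 - rho m₁ m₂ z) / 2 ≤ (w m₁ m₂ ξ z).re := by
  have h : ‖ξ.1‖ ^ (2 * m₁) + ‖ξ.2‖ ^ (2 * m₂) = 1 := hξ
  have h1 := le_wCoord_re hm₁ ξ.1 z.1
  have h2 := le_wCoord_re hm₂ ξ.2 z.2
  rw [w_eq, Complex.add_re, rho, ← h]
  linarith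

/-- If `w` vanished, the convexity inequalities in both coordinates would be equalities, and
strictness then forces `z = ξ` coordinate by coordinate. -/
lemma w_ne_zero {m₁ m₂ : ℝ} (hm₁ : 1 ≤ m₁) (hm₂ : 1 ≤ m₂) {ξ z : ℂ × ℂ} (hξ : ξ ∈ bdry m₁ m₂)
    (hz : rho m₁ m₂ z ≤ 1) (hne : z ≠ ξ) : w m₁ m₂ ξ z ≠ 0 := by
  intro h0
  have h : ‖ξ.1‖ ^ (2 * m₁) + ‖ξ.2‖ ^ (2 * m₂) = 1 := hξ
  have h1 := le_wCoord_re hm₁ ξ.1 z.1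
  have h2 := le_wCoord_re hm₂ ξ.2 z.2
  have h3 : (wCoord m₁ ξ.1 z.1).re + (wCoord m₂ ξ.2 z.2).re = 0 := by
    rw [← Complex.add_re, ← w_eq, h0, Complex.zero_re]
  rw [rho] at hz
  apply hne
  refine Prod.ext ?_ ?_
  · by_contra hc
    have := lt_wCoord_re hm₁ hc
    linarith
  · by_contra hc
    have := lt_wCoord_re hm₂ hc
    linarith

lemma rho_smul_le {m₁ m₂ : ℝ} (hm₁ : 1 ≤ m₁) (hm₂ : 1 ≤ m₂) {r : ℝ} (h0 : 0 ≤ r) (h1 : r ≤ 1)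
    (z : ℂ × ℂ) : rho m₁ m₂ (r • z) ≤ r * rho m₁ m₂ z := by
  have key : ∀ m : ℝ, 1 ≤ m → ∀ u : ℂ, ‖r • u‖ ^ (2 * m) ≤ r * ‖u‖ ^ (2 * m) := by
    intro m hm u
    rw [norm_smul, norm_of_nonneg h0, mul_rpow h0 (norm_nonneg _)]
    gcongr
    calc r ^ (2 * m) ≤ r ^ (1 : ℝ) := by
          rcases h0.eq_or_lt with rfl | h0
          · rw [zero_rpow (by linarith : 2 * m ≠ 0), rpow_one]
          · exact rpow_le_rpow_of_exponent_ge h0 h1 (by linarith)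
      _ = r := rpow_one r
  have a := key m₁ hm₁ z.1
  have b := key m₂ hm₂ z.2
  simp only [rho, Prod.smul_fst, Prod.smul_snd]
  linarith

lemma continuous_wCoord {m : ℝ} (hm : 1 ≤ m) : Continuous fun p : ℂ × ℂ => wCoord m p.1 p.2 := by
  have : Continuous fun p : ℂ × ℂ => ‖p.1‖ ^ (2 * (m - 1)) :=
    continuous_fst.norm.rpow_const fun _ => Or.inr (by linarith)
  unfold wCoord
  exact ((Complex.continuous_ofReal.comp (continuous_const.mul this)).mul
    (continuous_star.comp continuous_fst)).mul (continuous_fst.sub continuous_snd)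

lemma continuous_w {m₁ m₂ : ℝ} (hm₁ : 1 ≤ m₁) (hm₂ : 1 ≤ m₂) :
    Continuous fun p : (ℂ × ℂ) × (ℂ × ℂ) => w m₁ m₂ p.1 p.2 := by
  simp only [w_eq]
  exact ((continuous_wCoord hm₁).comp (f := fun p : (ℂ × ℂ) × (ℂ × ℂ) => (p.1.1, p.2.1))
    (by fun_prop)).add
    ((continuous_wCoord hm₂).comp (f := fun p : (ℂ × ℂ) × (ℂ × ℂ) => (p.1.2, p.2.2)) (by fun_prop))

lemma continuous_rho {m₁ m₂ : ℝ} (hm₁ : 1 ≤ m₁) (hm₂ : 1 ≤ m₂) : Continuous (rho m₁ m₂) :=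
  (continuous_fst.norm.rpow_const fun _ => Or.inr (by linarith)).add
    (continuous_snd.norm.rpow_const fun _ => Or.inr (by linarith))

lemma isCompact_bdry {m₁ m₂ : ℝ} (hm₁ : 1 ≤ m₁) (hm₂ : 1 ≤ m₂) : IsCompact (bdry m₁ m₂) := by
  have hcl : IsClosed (bdry m₁ m₂) := isClosed_eq (continuous_rho hm₁ hm₂) continuous_const
  refine Metric.isCompact_of_isClosed_isBounded hcl
    ((Metric.isBounded_closedBall (x := (0 : ℂ × ℂ)) (r := 1)).subset fun ξ hξ => ?_)
  have h : ‖ξ.1‖ ^ (2 * m₁) + ‖ξ.2‖ ^ (2 * m₂) = 1 := hξ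
  have h1 : 0 ≤ ‖ξ.1‖ ^ (2 * m₁) := by positivity
  have h2 : 0 ≤ ‖ξ.2‖ ^ (2 * m₂) := by positivity
  rw [mem_closedBall_zero_iff, Prod.norm_def, max_le_iff]
  constructor
  · by_contra! hc
    have := one_lt_rpow hc (by linarith : 0 < 2 * m₁)
    linarith
  · by_contra! hc
    have := one_lt_rpow hc (by linarith : 0 < 2 * m₂)
    linarith

/-! ### Polar coordinates and the measure `dS` -/

lemma one_sub_rpow_mem_Ioo {m r : ℝ} (hm : 1 ≤ m) (hr : r ∈ Ioo (0 : ℝ) 1) :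
    1 - r ^ (2 * m) ∈ Ioo (0 : ℝ) 1 := by
  have h1 : r ^ (2 * m) < 1 := rpow_lt_one hr.1.le hr.2 (by linarith)
  have h2 : 0 < r ^ (2 * m) := rpow_pos_of_pos hr.1 _
  constructor <;> linarith

lemma norm_param_fst (m₁ m₂ : ℝ) {t : ℝ × ℝ × ℝ} (ht : t.1 ∈ Ioo (0 : ℝ) 1) :
    ‖(param m₁ m₂ t).1‖ = t.1 := by
  simp [param, Complex.norm_exp_ofReal_mul_I, abs_of_pos ht.1]

lemma norm_param_snd {m₁ : ℝ} (hm₁ : 1 ≤ m₁) (m₂ : ℝ) {t : ℝ × ℝ × ℝ}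
    (ht : t.1 ∈ Ioo (0 : ℝ) 1) :
    ‖(param m₁ m₂ t).2‖ = (1 - t.1 ^ (2 * m₁)) ^ (1 / (2 * m₂)) := by
  have := rpow_nonneg (one_sub_rpow_mem_Ioo hm₁ ht).1.le (1 / (2 * m₂))
  simp only [param, norm_mul, Complex.norm_exp_ofReal_mul_I, mul_one, Complex.norm_real,
    norm_of_nonneg this]

lemma norm_param_snd_rpow {m₁ m₂ : ℝ} (hm₁ : 1 ≤ m₁) (hm₂ : 1 ≤ m₂) {t : ℝ × ℝ × ℝ}
    (ht : t.1 ∈ Ioo (0 : ℝ) 1) :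
    ‖(param m₁ m₂ t).2‖ ^ (2 * m₂) = 1 - t.1 ^ (2 * m₁) := by
  rw [norm_param_snd hm₁ m₂ ht, ← rpow_mul (one_sub_rpow_mem_Ioo hm₁ ht).1.le,
    one_div_mul_cancel (by linarith), rpow_one]

lemma param_mem_bdry {m₁ m₂ : ℝ} (hm₁ : 1 ≤ m₁) (hm₂ : 1 ≤ m₂) {t : ℝ × ℝ × ℝ}
    (ht : t.1 ∈ Ioo (0 : ℝ) 1) : param m₁ m₂ t ∈ bdry m₁ m₂ := by
  rw [bdry, mem_ofPred_eq, norm_param_snd_rpow hm₁ hm₂ ht, norm_param_fst m₁ m₂ ht]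
  ring

lemma arg_param_fst (m₁ m₂ : ℝ) {t : ℝ × ℝ × ℝ} (ht : t ∈ paramDomain) :
    Complex.arg (param m₁ m₂ t).1 = t.2.1 := by
  simp only [param, Complex.exp_mul_I]
  exact Complex.arg_mul_cos_add_sin_mul_I ht.1.1 ht.2.1

lemma arg_param_snd {m₁ : ℝ} (hm₁ : 1 ≤ m₁) (m₂ : ℝ) {t : ℝ × ℝ × ℝ} (ht : t ∈ paramDomain) :
    Complex.arg (param m₁ m₂ t).2 = t.2.2 := by
  simp only [param, Complex.exp_mul_I]
  exact Complex.arg_mul_cos_add_sin_mul_I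
    (rpow_pos_of_pos (one_sub_rpow_mem_Ioo hm₁ ht.1).1 _) ht.2.2

lemma hasDerivAt_radius {m₁ : ℝ} (hm₁ : 1 ≤ m₁) (m₂ : ℝ) {r : ℝ} (hr : r ∈ Ioo (0 : ℝ) 1) :
    HasDerivAt (fun r : ℝ => (1 - r ^ (2 * m₁)) ^ (1 / (2 * m₂)))
      (-(2 * m₁ * r ^ (2 * m₁ - 1)) * (1 / (2 * m₂)) *
        (1 - r ^ (2 * m₁)) ^ (1 / (2 * m₂) - 1)) r := by
  have h1 : HasDerivAt (fun r : ℝ => 1 - r ^ (2 * m₁)) (-(2 * m₁ * r ^ (2 * m₁ - 1))) r := by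
    simpa using (hasDerivAt_rpow_const (Or.inl hr.1.ne')).const_sub 1
  exact h1.rpow_const (Or.inl (one_sub_rpow_mem_Ioo hm₁ hr).1.ne')

lemma hasDerivAt_exp_mul_I (θ : ℝ) :
    HasDerivAt (fun θ : ℝ => Complex.exp (θ * Complex.I))
      (Complex.exp (θ * Complex.I) * Complex.I) θ := by
  have h : HasDerivAt (fun θ : ℝ => (θ : ℂ) * Complex.I) Complex.I θ := by
    simpa using (Complex.ofRealCLM.hasDerivAt (x := θ)).mul_const Complex.I
  exact h.cexp

lemma star_exp_mul_exp (θ : ℝ) :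
    star (Complex.exp (θ * Complex.I)) * Complex.exp (θ * Complex.I) = 1 := by
  rw [Complex.star_def, mul_comm, Complex.mul_conj']
  simp [Complex.norm_exp_ofReal_mul_I]

/-- The phases cancel and the boundary equation eliminates the second radius, leaving `dS = m₁ m₂
d(r₁^(2m₁)) dθ₁ dθ₂`. -/
lemma lerayDensity_eq {m₁ m₂ : ℝ} (hm₁ : 1 ≤ m₁) (hm₂ : 1 ≤ m₂) {t : ℝ × ℝ × ℝ}
    (ht : t.1 ∈ Ioo (0 : ℝ) 1) :
    lerayDensity m₁ m₂ t = 2 * m₁ ^ 2 * m₂ * t.1 ^ (2 * m₁ - 1) := by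
  have n1 := norm_param_fst m₁ m₂ ht
  have n2 := norm_param_snd hm₁ m₂ ht
  have n3 := norm_param_snd_rpow hm₁ hm₂ ht
  obtain ⟨r, θ, φ⟩ := t
  simp only at ht n1 n2 n3 ⊢
  set R : ℝ := (1 - r ^ (2 * m₁)) ^ (1 / (2 * m₂)) with hR
  set R' : ℝ := -(2 * m₁ * r ^ (2 * m₁ - 1)) * (1 / (2 * m₂)) *
        (1 - r ^ (2 * m₁)) ^ (1 / (2 * m₂) - 1) with hR'
  have hs := one_sub_rpow_mem_Ioo hm₁ ht
  have d1 : deriv (fun r : ℝ => param m₁ m₂ (r, θ, φ)) r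
      = (Complex.exp (θ * Complex.I), (R' : ℂ) * Complex.exp (φ * Complex.I)) := by
    refine HasDerivAt.deriv (HasDerivAt.prodMk ?_ ?_)
    · simpa using (Complex.ofRealCLM.hasDerivAt (x := r)).mul_const (Complex.exp (θ * Complex.I))
    · exact ((hasDerivAt_radius hm₁ m₂ ht).ofReal_comp).mul_const (Complex.exp (φ * Complex.I))
  have d2 : deriv (fun θ : ℝ => param m₁ m₂ (r, θ, φ)) θ
      = ((r : ℂ) * (Complex.exp (θ * Complex.I) * Complex.I), 0) :=
    HasDerivAt.deriv (((hasDerivAt_exp_mul_I θ).const_mul (r : ℂ)).prodMk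
      (hasDerivAt_const _ ((R : ℂ) * Complex.exp (φ * Complex.I))))
  have d3 : deriv (fun φ : ℝ => param m₁ m₂ (r, θ, φ)) φ
      = (0, (R : ℂ) * (Complex.exp (φ * Complex.I) * Complex.I)) :=
    HasDerivAt.deriv ((hasDerivAt_const _ ((r : ℂ) * Complex.exp (θ * Complex.I))).prodMk
      ((hasDerivAt_exp_mul_I φ).const_mul (R : ℂ)))
  rw [lerayDensity, d1, d2, d3]
  have e1 := star_exp_mul_exp θ
  have e2 := star_exp_mul_exp φ
  have hRpos : 0 < R := rpow_pos_of_pos hs.1 _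
  have hx : r ^ (2 * (m₁ - 1)) * r ^ 2 = r ^ (2 * m₁) :=
    rpow_two_mul_sub_one_mul_sq hm₁ ht.1.le
  have hx' : r ^ (2 * m₁ - 1) = r ^ (2 * (m₁ - 1)) * r := by
    nth_rewrite 3 [← rpow_one r]
    rw [← rpow_add ht.1]; congr 1; ring
  have hy : R ^ (2 * (m₂ - 1)) * R ^ 2 = 1 - r ^ (2 * m₁) := by
    rw [rpow_two_mul_sub_one_mul_sq hm₂ hRpos.le, ← n2, n3]
  -- This is the derivative of the boundary equation `r^(2m₁) + R^(2m₂) = 1`, multiplied by `R`.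
  have hR1 : m₂ * R' * (1 - r ^ (2 * m₁)) = -(m₁ * r ^ (2 * m₁ - 1) * R) := by
    have : (1 - r ^ (2 * m₁)) ^ (1 / (2 * m₂) - 1) * (1 - r ^ (2 * m₁)) = R := by
      rw [hR, rpow_sub_one hs.1.ne', div_mul_cancel₀ _ hs.1.ne']
    rw [← this, hR']
    field_simp
  set x := r ^ (2 * (m₁ - 1))
  set y := R ^ (2 * (m₂ - 1))
  have key : 2 * (m₁ * x) * (m₂ * y) * r * R * (m₂ * r * R' - m₁ * R)
      = -(2 * m₁ ^ 2 * m₂ * (x * r)) := by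
    rw [hx'] at hR1
    rw [← hx] at hR1 hy hs
    have h0 := hs.1.ne'
    have h1 : (m₂ * r * R' - m₁ * R) * (1 - x * r ^ 2) = - m₁ * R := by
      linear_combination r * hR1
    apply mul_right_cancel₀ h0
    calc _ = 2 * (m₁ * x) * (m₂ * y) * r * R * ((m₂ * r * R' - m₁ * R) * (1 - x * r ^ 2)) := by
          ring
      _ = _ := by rw [h1, ← hy]; ring
  have keyC : lerayForm m₁ m₂ (param m₁ m₂ (r, θ, φ))
      (Complex.exp (θ * Complex.I), (R' : ℂ) * Complex.exp (φ * Complex.I))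
      ((r : ℂ) * (Complex.exp (θ * Complex.I) * Complex.I), 0)
      (0, (R : ℂ) * (Complex.exp (φ * Complex.I) * Complex.I))
      = ((2 * (m₁ * x) * (m₂ * y) * r * R * (m₂ * r * R' - m₁ * R) : ℝ) : ℂ) := by
    have p1 : (param m₁ m₂ (r, θ, φ)).1 = (r : ℂ) * Complex.exp (θ * Complex.I) := rfl
    have p2 : (param m₁ m₂ (r, θ, φ)).2 = (R : ℂ) * Complex.exp (φ * Complex.I) := rfl
    simp only [lerayForm, dRho, ddRho, n1, n2]
    rw [p1, p2]
    simp only [star_mul', Complex.star_def, Complex.conj_ofReal, Complex.conj_I] at e1 e2 ⊢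
    set E := Complex.exp (θ * Complex.I)
    set F := Complex.exp (φ * Complex.I)
    set E' := (starRingEnd ℂ) E
    set F' := (starRingEnd ℂ) F
    have hI := Complex.I_sq
    push_cast
    simp only [map_zero, mul_zero, zero_mul, sub_zero, add_zero, zero_add, zero_sub]
    linear_combination
      (2 * (m₁ * x) * (m₂ * y) * r * R * (m₁ * R - m₂ * r * R') : ℂ) * (E' * E * (F' * F)) * hI
      - (2 * (m₁ * x) * (m₂ * y) * r * R * (m₁ * R - m₂ * r * R') : ℂ) * (F' * F) * e1
      - (2 * (m₁ * x) * (m₂ * y) * r * R * (m₁ * R - m₂ * r * R') : ℂ) * e2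
  rw [keyC, key, Complex.norm_real, hx', norm_neg, norm_of_nonneg]
  have := rpow_nonneg ht.1.le (2 * (m₁ - 1))
  have := ht.1.le
  positivity

/-- The radial factor of `dS` in the coordinates of `param`. -/
def radialMeasure (m₁ m₂ : ℝ) : Measure ℝ :=
  (volume.restrict (Ioo (0 : ℝ) 1)).withDensity
    fun r => ENNReal.ofReal (2 * m₁ ^ 2 * m₂ * r ^ (2 * m₁ - 1))

/-- The measure `dS` in the coordinates of `param`. -/
def paramMeasure (m₁ m₂ : ℝ) : Measure (ℝ × ℝ × ℝ) :=
  (radialMeasure m₁ m₂).prod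
    ((volume.restrict (Ioc (-π) π)).prod (volume.restrict (Ioc (-π) π)))

lemma measurable_param (m₁ m₂ : ℝ) : Measurable (param m₁ m₂) := by
  unfold param
  fun_prop

instance isFiniteMeasure_radialMeasure (m₁ m₂ : ℝ) [Fact (1 ≤ m₁)] :
    IsFiniteMeasure (radialMeasure m₁ m₂) := by
  have hm₁ : 1 ≤ m₁ := Fact.out
  refine isFiniteMeasure_withDensity_ofReal (Integrable.hasFiniteIntegral ?_)
  have : IntervalIntegrable (fun r : ℝ => 2 * m₁ ^ 2 * m₂ * r ^ (2 * m₁ - 1)) volume 0 1 :=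
    (intervalIntegral.intervalIntegrable_rpow' (by linarith)).const_mul _
  exact this.1.mono_set Ioo_subset_Ioc_self

instance isFiniteMeasure_paramMeasure (m₁ m₂ : ℝ) [Fact (1 ≤ m₁)] :
    IsFiniteMeasure (paramMeasure m₁ m₂) := by
  unfold paramMeasure; infer_instance

lemma lerayMeasure_eq {m₁ m₂ : ℝ} (hm₁ : 1 ≤ m₁) (hm₂ : 1 ≤ m₂) :
    lerayMeasure m₁ m₂ = (paramMeasure m₁ m₂).map (param m₁ m₂) := by
  have : (volume.restrict paramDomain : Measure (ℝ × ℝ × ℝ)).withDensity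
      (fun t => ENNReal.ofReal (lerayDensity m₁ m₂ t)) = paramMeasure m₁ m₂ := by
    rw [paramMeasure, radialMeasure, prod_withDensity_left (by fun_prop),
      Measure.prod_restrict, Measure.prod_restrict, ← Measure.volume_eq_prod,
      ← Measure.volume_eq_prod, ← paramDomain]
    refine withDensity_congr_ae ?_
    have hD : MeasurableSet paramDomain :=
      measurableSet_Ioo.prod (measurableSet_Ioc.prod measurableSet_Ioc)
    filter_upwards [ae_restrict_mem hD] with t ht
    rw [lerayDensity_eq hm₁ hm₂ ht.1]
  rw [lerayMeasure, this]

instance isFiniteMeasure_lerayMeasure (m₁ m₂ : ℝ) [Fact (1 ≤ m₁)] [Fact (1 ≤ m₂)] :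
    IsFiniteMeasure (lerayMeasure m₁ m₂) := by
  rw [lerayMeasure_eq Fact.out Fact.out]; infer_instance

lemma ae_paramMeasure {m₁ m₂ : ℝ} [Fact (1 ≤ m₁)] {P Q : ℝ → Prop}
    (hP : ∀ᵐ r ∂(radialMeasure m₁ m₂), P r)
    (hQ : ∀ᵐ θ ∂(volume.restrict (Ioc (-π) π)), Q θ) :
    ∀ᵐ t ∂(paramMeasure m₁ m₂), P t.1 ∧ Q t.2.1 ∧ Q t.2.2 := by
  have h1 := Measure.quasiMeasurePreserving_fst
    (μ := volume.restrict (Ioc (-π) π)) (ν := volume.restrict (Ioc (-π) π)) |>.ae hQ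
  have h2 := Measure.quasiMeasurePreserving_snd
    (μ := volume.restrict (Ioc (-π) π)) (ν := volume.restrict (Ioc (-π) π)) |>.ae hQ
  have h3 := Measure.quasiMeasurePreserving_fst (μ := radialMeasure m₁ m₂)
    (ν := (volume.restrict (Ioc (-π) π)).prod (volume.restrict (Ioc (-π) π))) |>.ae hP
  have h4 := Measure.quasiMeasurePreserving_snd (μ := radialMeasure m₁ m₂)
    (ν := (volume.restrict (Ioc (-π) π)).prod (volume.restrict (Ioc (-π) π))) |>.ae (h1.and h2)
  filter_upwards [h3, h4] with t a b using ⟨a, b⟩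

lemma ae_mem_paramDomain (m₁ m₂ : ℝ) [Fact (1 ≤ m₁)] :
    ∀ᵐ t ∂(paramMeasure m₁ m₂), t ∈ paramDomain := by
  have h1 : ∀ᵐ r ∂(radialMeasure m₁ m₂), r ∈ Ioo (0 : ℝ) 1 :=
    (withDensity_absolutelyContinuous _ _).ae_le (ae_restrict_mem measurableSet_Ioo)
  have h2 : ∀ᵐ θ ∂(volume.restrict (Ioc (-π) π)), θ ∈ Ioc (-π) π :=
    ae_restrict_mem measurableSet_Ioc
  exact ae_paramMeasure h1 h2

lemma ae_notMem_countable (m₁ m₂ : ℝ) [Fact (1 ≤ m₁)] {S : Set ℝ} (hS : S.Countable) :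
    ∀ᵐ t ∂(paramMeasure m₁ m₂), t.1 ∉ S ∧ t.2.1 ∉ S ∧ t.2.2 ∉ S := by
  have h0 : ∀ᵐ r ∂(volume : Measure ℝ), r ∉ S := hS.ae_notMem _
  have h1 : ∀ᵐ r ∂(radialMeasure m₁ m₂), r ∉ S :=
    (withDensity_absolutelyContinuous _ _).ae_le (ae_restrict_of_ae h0)
  have h2 : ∀ᵐ θ ∂(volume.restrict (Ioc (-π) π)), θ ∉ S := ae_restrict_of_ae h0
  exact ae_paramMeasure h1 h2

/-- A subset of the boundary given by conditions on `θ₁`, `θ₂` and `r₁ ^ (2 m₁)`. -/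
def box (m₁ m₂ : ℝ) (I J K : Set ℝ) : Set (ℂ × ℂ) :=
  {ξ | ξ ∈ bdry m₁ m₂ ∧ Complex.arg ξ.1 ∈ I ∧ Complex.arg ξ.2 ∈ J ∧ ‖ξ.1‖ ^ (2 * m₁) ∈ K}

lemma measurableSet_bdry (m₁ m₂ : ℝ) : MeasurableSet (bdry m₁ m₂) :=
  measurableSet_eq_fun (by fun_prop) measurable_const

lemma measurableSet_box (m₁ m₂ : ℝ) {I J K : Set ℝ} (hI : MeasurableSet I)
    (hJ : MeasurableSet J) (hK : MeasurableSet K) : MeasurableSet (box m₁ m₂ I J K) := by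
  refine (measurableSet_bdry m₁ m₂).inter (MeasurableSet.inter ?_ (MeasurableSet.inter ?_ ?_))
  · exact (Complex.measurable_arg.comp measurable_fst) hI
  · exact (Complex.measurable_arg.comp measurable_snd) hJ
  · exact (by fun_prop : Measurable fun ξ : ℂ × ℂ => ‖ξ.1‖ ^ (2 * m₁)) hK

lemma ae_mem_bdry (m₁ m₂ : ℝ) [Fact (1 ≤ m₁)] [Fact (1 ≤ m₂)] :
    ∀ᵐ ξ ∂(lerayMeasure m₁ m₂), ξ ∈ bdry m₁ m₂ := by
  rw [lerayMeasure_eq Fact.out Fact.out]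
  refine (ae_map_iff (measurable_param m₁ m₂).aemeasurable (measurableSet_bdry m₁ m₂)).2 ?_
  filter_upwards [ae_mem_paramDomain m₁ m₂] with t ht using
    param_mem_bdry Fact.out Fact.out ht.1

/-- No coordinate has atoms, so countably many values of the angles and of `r₁^(2m₁)` can be
discarded. This removes the edges of all patches at once. -/
lemma ae_mem_box_compl (m₁ m₂ : ℝ) [Fact (1 ≤ m₁)] [Fact (1 ≤ m₂)] {S : Set ℝ}
    (hS : S.Countable) : ∀ᵐ ξ ∂(lerayMeasure m₁ m₂), ξ ∈ box m₁ m₂ Sᶜ Sᶜ Sᶜ := by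
  have hm₁ : 1 ≤ m₁ := Fact.out
  have hm₂ : 1 ≤ m₂ := Fact.out
  have hSm := hS.measurableSet.compl
  rw [lerayMeasure_eq hm₁ hm₂]
  refine (ae_map_iff (measurable_param m₁ m₂).aemeasurable
    (measurableSet_box m₁ m₂ hSm hSm hSm)).2 ?_
  filter_upwards [ae_mem_paramDomain m₁ m₂, ae_notMem_countable m₁ m₂ hS,
    ae_notMem_countable m₁ m₂ (hS.image fun s => s ^ (2 * m₁)⁻¹)] with t ht h1 h2
  refine ⟨param_mem_bdry hm₁ hm₂ ht.1, ?_, ?_, ?_⟩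
  · rw [arg_param_fst m₁ m₂ ht]; exact h1.2.1
  · rw [arg_param_snd hm₁ m₂ ht]; exact h1.2.2
  · rw [norm_param_fst m₁ m₂ ht.1]
    exact fun hc => h2.1 ⟨_, hc, rpow_rpow_inv ht.1.1.le (by linarith)⟩

/-- In the variable `r^(2m₁)` the radial measure is `m₁ m₂` times Lebesgue measure. -/
lemma radialMeasure_rpow_mem_Icc {m₁ m₂ : ℝ} (hm₁ : 1 ≤ m₁) (hm₂ : 1 ≤ m₂) {a b : ℝ}
    (ha : 0 < a) (hab : a ≤ b) (hb : b < 1) :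
    radialMeasure m₁ m₂ ({r | r ^ (2 * m₁) ∈ Icc a b} ∩ Ioo 0 1)
      = ENNReal.ofReal (m₁ * m₂ * (b - a)) := by
  have hpos : 0 < 2 * m₁ := by linarith
  have hm : (2 * m₁)⁻¹ * (2 * m₁) = 1 := inv_mul_cancel₀ hpos.ne'
  have hset : {r : ℝ | r ^ (2 * m₁) ∈ Icc a b} ∩ Ioo 0 1
      = Icc (a ^ (2 * m₁)⁻¹) (b ^ (2 * m₁)⁻¹) := by
    ext r
    constructor
    · rintro ⟨⟨h1, h2⟩, h3⟩
      constructor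
      · rw [rpow_inv_le_iff_of_pos ha.le h3.1.le hpos]; exact h1
      · rw [le_rpow_inv_iff_of_pos h3.1.le (ha.le.trans hab) hpos]; exact h2
    · rintro ⟨h1, h2⟩
      have h0 : 0 < r := lt_of_lt_of_le (rpow_pos_of_pos ha _) h1
      rw [rpow_inv_le_iff_of_pos ha.le h0.le hpos] at h1
      have h3 := h2
      rw [le_rpow_inv_iff_of_pos h0.le (ha.le.trans hab) hpos] at h2
      exact ⟨⟨h1, h2⟩, h0, h3.trans_lt (rpow_lt_one (ha.le.trans hab) hb (by positivity))⟩
  have hle : a ^ (2 * m₁)⁻¹ ≤ b ^ (2 * m₁)⁻¹ := by gcongr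
  have hsub : Icc (a ^ (2 * m₁)⁻¹) (b ^ (2 * m₁)⁻¹) ⊆ Ioo 0 1 := hset ▸ inter_subset_right
  have hint : IntervalIntegrable (fun r : ℝ => 2 * m₁ ^ 2 * m₂ * r ^ (2 * m₁ - 1)) volume
      (a ^ (2 * m₁)⁻¹) (b ^ (2 * m₁)⁻¹) :=
    (intervalIntegral.intervalIntegrable_rpow' (by linarith)).const_mul _
  rw [hset, radialMeasure, withDensity_apply _ measurableSet_Icc,
    Measure.restrict_restrict measurableSet_Icc, inter_eq_left.2 hsub,
    ← ofReal_integral_eq_lintegral_ofReal, integral_Icc_eq_integral_Ioc,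
    ← intervalIntegral.integral_of_le hle, intervalIntegral.integral_const_mul,
    integral_rpow (Or.inl (by linarith)), sub_add_cancel, ← rpow_mul (ha.le.trans hab),
    ← rpow_mul ha.le, hm, rpow_one, rpow_one]
  · congr 1; field_simp
  · exact (intervalIntegrable_iff_integrableOn_Icc_of_le hle).1 hint
  · filter_upwards [ae_restrict_mem measurableSet_Icc] with r hr
    have := rpow_nonneg (hsub hr).1.le (2 * m₁ - 1)
    positivity

lemma lerayMeasure_box {m₁ m₂ : ℝ} (hm₁ : 1 ≤ m₁) (hm₂ : 1 ≤ m₂) {I J : Set ℝ}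
    (hI : MeasurableSet I) (hJ : MeasurableSet J) (hI' : I ⊆ Ioc (-π) π) (hJ' : J ⊆ Ioc (-π) π)
    {a b : ℝ} (ha : 0 < a) (hab : a ≤ b) (hb : b < 1) :
    lerayMeasure m₁ m₂ (box m₁ m₂ I J (Icc a b))
      = ENNReal.ofReal (m₁ * m₂ * (b - a)) * (volume I * volume J) := by
  have : Fact (1 ≤ m₁) := ⟨hm₁⟩
  have hM : MeasurableSet {r : ℝ | r ^ (2 * m₁) ∈ Icc a b} :=
    (by fun_prop : Measurable fun r : ℝ => r ^ (2 * m₁)) measurableSet_Icc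
  rw [lerayMeasure_eq hm₁ hm₂, Measure.map_apply (measurable_param m₁ m₂)
    (measurableSet_box m₁ m₂ hI hJ measurableSet_Icc)]
  have : param m₁ m₂ ⁻¹' box m₁ m₂ I J (Icc a b) =ᵐ[paramMeasure m₁ m₂]
      (({r : ℝ | r ^ (2 * m₁) ∈ Icc a b} ∩ Ioo 0 1) ×ˢ I ×ˢ J : Set (ℝ × ℝ × ℝ)) := by
    filter_upwards [ae_mem_paramDomain m₁ m₂] with t ht
    refine propext (?_ : param m₁ m₂ t ∈ box m₁ m₂ I J (Icc a b) ↔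
      t ∈ (({r : ℝ | r ^ (2 * m₁) ∈ Icc a b} ∩ Ioo 0 1) ×ˢ I ×ˢ J : Set (ℝ × ℝ × ℝ)))
    simp only [box, mem_ofPred_eq, arg_param_fst m₁ m₂ ht, arg_param_snd hm₁ m₂ ht,
      norm_param_fst m₁ m₂ ht.1, mem_prod, mem_inter_iff]
    have := param_mem_bdry hm₁ hm₂ ht.1
    have := ht.1
    tauto
  rw [measure_congr this, paramMeasure, Measure.prod_prod, Measure.prod_prod,
    radialMeasure_rpow_mem_Icc hm₁ hm₂ ha hab hb, Measure.restrict_apply hI,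
    Measure.restrict_apply hJ, inter_eq_left.2 hI', inter_eq_left.2 hJ']

/-! ### The image of a constant -/

/-- Mean value property of `1/(A - bz)²`, holomorphic near the closed unit disc because `|b| < |A|`;
conjugating the phase only reverses the circle. -/
lemma integral_one_div_sub_mul_exp_sq {A b : ℂ} (h : ‖b‖ < ‖A‖) :
    ∫ θ in Ioc (-π) π, 1 / (A - b * star (Complex.exp ((θ : ℝ) * Complex.I))) ^ 2
      = 2 * π / A ^ 2 := by
  have hne : ∀ z ∈ Metric.closedBall (0 : ℂ) 1, A - b * z ≠ 0 := by
    intro z hz h0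
    rw [mem_closedBall_zero_iff] at hz
    have : ‖A‖ ≤ ‖b‖ := by
      rw [sub_eq_zero.1 h0, norm_mul]; exact mul_le_of_le_one_right (norm_nonneg _) hz
    linarith
  set F : ℂ → ℂ := fun z => 1 / (A - b * z) ^ 2 with hF
  have hd : DiffContOnCl ℂ F (Metric.ball 0 |1|) := by
    refine DifferentiableOn.diffContOnCl ?_
    rw [abs_one, closure_ball _ one_ne_zero]
    intro z hz
    have := hne z hz
    exact (DifferentiableAt.div (by fun_prop) (by fun_prop) (by positivity)).differentiableWithinAt
  have hm := hd.circleAverage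
  rw [Real.circleAverage_def] at hm
  have hstar : ∀ θ : ℝ, star (Complex.exp (θ * Complex.I)) = circleMap 0 1 (-θ) := by
    intro θ
    simp [circleMap, ← Complex.exp_conj]
  have hper : Function.Periodic (fun θ : ℝ => F (circleMap 0 1 θ)) (2 * π) := fun θ => by
    simp only [periodic_circleMap 0 1 θ]
  have h1 : ∫ θ in (-π)..π, F (circleMap 0 1 θ) = ∫ θ in 0..(2 * π), F (circleMap 0 1 θ) := by
    have := hper.intervalIntegral_add_eq (-π) 0
    rwa [zero_add, show -π + 2 * π = π by ring] at this
  have h2 : ∫ θ in (-π)..π, F (circleMap 0 1 (-θ)) = ∫ θ in (-π)..π, F (circleMap 0 1 θ) := by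
    rw [intervalIntegral.integral_comp_neg (fun θ => F (circleMap 0 1 θ)), neg_neg]
  rw [← intervalIntegral.integral_of_le (by linarith [pi_pos])]
  simp only [hstar]
  change ∫ θ in (-π)..π, F (circleMap 0 1 (-θ)) = _
  rw [h2, h1]
  have hpi : (2 * π : ℝ) ≠ 0 := by positivity
  rw [inv_smul_eq_iff₀ hpi] at hm
  rw [hm, hF]
  simp [div_eq_mul_inv]

lemma continuous_w_comp {X : Type*} [TopologicalSpace X] {m₁ m₂ : ℝ} (hm₁ : 1 ≤ m₁) (hm₂ : 1 ≤ m₂)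
    {f g : X → ℂ × ℂ} (hf : Continuous f) (hg : Continuous g) :
    Continuous fun x => w m₁ m₂ (f x) (g x) :=
  Continuous.comp (g := fun p : (ℂ × ℂ) × (ℂ × ℂ) => w m₁ m₂ p.1 p.2) (f := fun x => (f x, g x))
    (continuous_w hm₁ hm₂) (hf.prodMk hg)

lemma measurable_w {m₁ m₂ : ℝ} (hm₁ : 1 ≤ m₁) (hm₂ : 1 ≤ m₂) (z : ℂ × ℂ) :
    Measurable fun ξ => w m₁ m₂ ξ z :=
  (continuous_w_comp hm₁ hm₂ continuous_id continuous_const).measurable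

lemma norm_div_sq_le {η : ℝ} (hη : 0 < η) {x : ℂ} (hx : η ≤ ‖x‖) (a : ℂ) :
    ‖a / x ^ 2‖ ≤ 1 / η ^ 2 * ‖a‖ := by
  rw [norm_div, norm_pow, div_eq_mul_one_div, mul_comm]
  gcongr

lemma norm_one_div_sq_le {η : ℝ} (hη : 0 < η) {x : ℂ} (hx : η ≤ ‖x‖) :
    ‖1 / x ^ 2‖ ≤ 1 / η ^ 2 := by
  simpa using norm_div_sq_le hη hx 1

lemma mul_rpow_mul_le {m R b : ℝ} (hm : 1 ≤ m) (hR : 0 ≤ R) (hb : 0 ≤ b) :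
    m * R ^ (2 * (m - 1)) * R * b ≤ m * R ^ (2 * m) - (R ^ (2 * m) - b ^ (2 * m)) / 2 := by
  by_cases h : R = b
  · subst h
    rw [mul_assoc, mul_assoc, ← sq, rpow_two_mul_sub_one_mul_sq hm hR]; simp
  · have := two_mul_rpow_mul_lt hm hR hb h
    nlinarith

lemma wCoord_polar {m : ℝ} (hm : 1 ≤ m) {R : ℝ} (hR : 0 ≤ R) (θ : ℝ) (z : ℂ) :
    wCoord m ((R : ℂ) * Complex.exp (θ * Complex.I)) z = ((m * R ^ (2 * m) : ℝ) : ℂ)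
      - ((m * R ^ (2 * (m - 1)) * R : ℝ) : ℂ) * z * star (Complex.exp (θ * Complex.I)) := by
  have : ‖(R : ℂ) * Complex.exp (θ * Complex.I)‖ = R := by
    simp [Complex.norm_exp_ofReal_mul_I, abs_of_nonneg hR]
  rw [wCoord_eq hm, this, star_mul', Complex.star_def, Complex.conj_ofReal]
  push_cast; ring

lemma w_param_ne {m₁ m₂ : ℝ} (hm₁ : 1 ≤ m₁) (hm₂ : 1 ≤ m₂) (z : ℂ × ℂ)
    {t : ℝ × ℝ × ℝ} (ht : t.1 ∈ Ioo (0 : ℝ) 1) :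
    (1 - rho m₁ m₂ z) / 2 ≤ ‖w m₁ m₂ (param m₁ m₂ t) z‖ :=
  (le_w_re hm₁ hm₂ (param_mem_bdry hm₁ hm₂ ht) z).trans (Complex.re_le_norm _)

/-- For fixed radii `w` is affine in the conjugate phases, `c - a₁ e^{-iθ} - a₂ e^{-iφ}`, and its
constant term dominates. Two mean values then replace it by `c`, which does not involve `z`. -/
lemma integral_angles {m₁ m₂ : ℝ} (hm₁ : 1 ≤ m₁) (hm₂ : 1 ≤ m₂) {z : ℂ × ℂ}
    (hz : rho m₁ m₂ z < 1) {r : ℝ} (hr : r ∈ Ioo (0 : ℝ) 1) :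
    ∫ s, 1 / (w m₁ m₂ (param m₁ m₂ (r, s)) z) ^ 2
      ∂((volume.restrict (Ioc (-π) π)).prod (volume.restrict (Ioc (-π) π)))
      = 2 * π * (2 * π) / ((m₁ * r ^ (2 * m₁) + m₂ * (1 - r ^ (2 * m₁)) : ℝ) : ℂ) ^ 2 := by
  have hη : 0 < (1 - rho m₁ m₂ z) / 2 := by linarith
  have hmeas : Measurable fun s : ℝ × ℝ => w m₁ m₂ (param m₁ m₂ (r, s)) z :=
    (measurable_w hm₁ hm₂ z).comp
      ((measurable_param m₁ m₂).comp (measurable_const.prodMk measurable_id))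
  have hint : Integrable (fun s : ℝ × ℝ => 1 / (w m₁ m₂ (param m₁ m₂ (r, s)) z) ^ 2)
      ((volume.restrict (Ioc (-π) π)).prod (volume.restrict (Ioc (-π) π))) := by
    refine Integrable.of_bound (C := 1 / ((1 - rho m₁ m₂ z) / 2) ^ 2)
      (measurable_const.div (hmeas.pow_const 2)).aestronglyMeasurable
      (Eventually.of_forall fun s => ?_)
    exact norm_one_div_sq_le hη (w_param_ne hm₁ hm₂ z (t := (r, s)) hr)
  rw [integral_prod _ hint]
  set R : ℝ := (1 - r ^ (2 * m₁)) ^ (1 / (2 * m₂)) with hR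
  have hR0 : 0 ≤ R := rpow_nonneg (one_sub_rpow_mem_Ioo hm₁ hr).1.le _
  have hRm : R ^ (2 * m₂) = 1 - r ^ (2 * m₁) := by
    have h1 := norm_param_snd_rpow hm₁ hm₂ (t := (r, 0, 0)) hr
    rwa [norm_param_snd hm₁ m₂ (t := (r, 0, 0)) hr] at h1
  set a₁ : ℂ := ((m₁ * r ^ (2 * (m₁ - 1)) * r : ℝ) : ℂ) * z.1 with ha₁
  set a₂ : ℂ := ((m₂ * R ^ (2 * (m₂ - 1)) * R : ℝ) : ℂ) * z.2 with ha₂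
  set c : ℝ := m₁ * r ^ (2 * m₁) + m₂ * (1 - r ^ (2 * m₁)) with hc
  have hw : ∀ θ φ : ℝ, w m₁ m₂ (param m₁ m₂ (r, θ, φ)) z
      = ((c : ℂ) - a₁ * star (Complex.exp (θ * Complex.I)))
        - a₂ * star (Complex.exp (φ * Complex.I)) := by
    intro θ φ
    rw [w_eq]
    change wCoord m₁ ((r : ℂ) * Complex.exp (θ * Complex.I)) z.1 +
      wCoord m₂ ((R : ℂ) * Complex.exp (φ * Complex.I)) z.2 = _
    rw [wCoord_polar hm₁ hr.1.le, wCoord_polar hm₂ hR0, hRm, ha₁, ha₂, hc]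
    push_cast; ring
  have hb₁ : ‖a₁‖ = m₁ * r ^ (2 * (m₁ - 1)) * r * ‖z.1‖ := by
    have := rpow_nonneg hr.1.le (2 * (m₁ - 1))
    have := hr.1.le
    rw [ha₁, norm_mul, Complex.norm_real, norm_of_nonneg (by positivity)]
  have hb₂ : ‖a₂‖ = m₂ * R ^ (2 * (m₂ - 1)) * R * ‖z.2‖ := by
    rw [ha₂, norm_mul, Complex.norm_real, norm_of_nonneg (by positivity)]
  -- The sum of the two convexity bounds is `c - (1 - rho z)/2`.
  have hlt : ‖a₁‖ + ‖a₂‖ < c := by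
    have h1 := mul_rpow_mul_le hm₁ hr.1.le (norm_nonneg z.1)
    have h2 := mul_rpow_mul_le hm₂ hR0 (norm_nonneg z.2)
    rw [rho] at hz
    rw [hRm] at h2
    rw [hb₁, hb₂, hc]
    linarith
  have hc0 : ‖(c : ℂ)‖ = c := by
    rw [Complex.norm_real, norm_of_nonneg]
    linarith [norm_nonneg a₁, norm_nonneg a₂]
  have hinner : ∀ θ : ℝ, ∫ φ in Ioc (-π) π, 1 / (w m₁ m₂ (param m₁ m₂ (r, θ, φ)) z) ^ 2
      = 2 * π * (1 / ((c : ℂ) - a₁ * star (Complex.exp (θ * Complex.I))) ^ 2) := by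
    intro θ
    simp only [hw]
    rw [integral_one_div_sub_mul_exp_sq]
    · ring
    · have h1 := norm_sub_norm_le (c : ℂ) (a₁ * star (Complex.exp (θ * Complex.I)))
      rw [norm_mul, norm_star, Complex.norm_exp_ofReal_mul_I, hc0, mul_one] at h1
      linarith
  simp only [hinner]
  rw [integral_const_mul, integral_one_div_sub_mul_exp_sq]
  · ring
  · rw [hc0]; linarith [norm_nonneg a₂]

lemma cauchyLF_const {m₁ m₂ : ℝ} (hm₁ : 1 ≤ m₁) (hm₂ : 1 ≤ m₂) (c : ℂ) {z : ℂ × ℂ}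
    (hz : rho m₁ m₂ z < 1) :
    cauchyLF m₁ m₂ (fun _ => c) z = cauchyLF m₁ m₂ (fun _ => c) 0 := by
  have : Fact (1 ≤ m₁) := ⟨hm₁⟩
  have : Fact (1 ≤ m₂) := ⟨hm₂⟩
  have key : ∀ z : ℂ × ℂ, rho m₁ m₂ z < 1 → ∫ ξ, 1 / (w m₁ m₂ ξ z) ^ 2 ∂(lerayMeasure m₁ m₂)
      = ∫ r, 2 * π * (2 * π) / ((m₁ * r ^ (2 * m₁) + m₂ * (1 - r ^ (2 * m₁)) : ℝ) : ℂ) ^ 2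
        ∂(radialMeasure m₁ m₂) := by
    intro z hz
    have hη : 0 < (1 - rho m₁ m₂ z) / 2 := by linarith
    have hmeas' : Measurable fun ξ : ℂ × ℂ => 1 / (w m₁ m₂ ξ z) ^ 2 :=
      measurable_const.div ((measurable_w hm₁ hm₂ z).pow_const 2)
    have hint : Integrable (fun t => 1 / (w m₁ m₂ (param m₁ m₂ t) z) ^ 2)
        (paramMeasure m₁ m₂) := by
      refine Integrable.of_bound (C := 1 / ((1 - rho m₁ m₂ z) / 2) ^ 2)
        (hmeas'.comp (measurable_param m₁ m₂)).aestronglyMeasurable ?_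
      filter_upwards [ae_mem_paramDomain m₁ m₂] with t ht
      exact norm_one_div_sq_le hη (w_param_ne hm₁ hm₂ z ht.1)
    rw [lerayMeasure_eq hm₁ hm₂, integral_map (measurable_param m₁ m₂).aemeasurable
      hmeas'.aestronglyMeasurable]
    rw [paramMeasure] at hint ⊢
    rw [integral_prod _ hint]
    refine integral_congr_ae ?_
    have h1 : ∀ᵐ r ∂(radialMeasure m₁ m₂), r ∈ Ioo (0 : ℝ) 1 :=
      (withDensity_absolutelyContinuous _ _).ae_le (ae_restrict_mem measurableSet_Ioo)
    filter_upwards [h1] with r hr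
    exact integral_angles hm₁ hm₂ hz hr
  have h0 : rho m₁ m₂ 0 < 1 := by
    simp [rho, zero_rpow (by linarith : 2 * m₁ ≠ 0), zero_rpow (by linarith : 2 * m₂ ≠ 0)]
  have hcast : ∀ z : ℂ × ℂ, ∫ ξ, c / (w m₁ m₂ ξ z) ^ 2 ∂(lerayMeasure m₁ m₂)
      = c * ∫ ξ, 1 / (w m₁ m₂ ξ z) ^ 2 ∂(lerayMeasure m₁ m₂) := by
    intro z
    rw [← integral_const_mul]
    simp only [mul_one_div]
  rw [cauchyLF, cauchyLF, hcast, hcast, key z hz, key 0 h0]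

/-! ### Radial limits at points of local constancy -/

/-- Compactness: a zero of `w` would need `ξ = r z` on the boundary, hence `r = 1` and `ξ = z ∈ U`.
-/
lemma exists_le_norm_w {m₁ m₂ : ℝ} (hm₁ : 1 ≤ m₁) (hm₂ : 1 ≤ m₂) {z : ℂ × ℂ}
    (hz : z ∈ bdry m₁ m₂) {U : Set (ℂ × ℂ)} (hU : IsOpen U) (hzU : z ∈ U) :
    ∃ η : ℝ, 0 < η ∧ ∀ ξ ∈ bdry m₁ m₂, ξ ∉ U → ∀ r ∈ Icc (0 : ℝ) 1,
      η ≤ ‖w m₁ m₂ ξ (r • z)‖ := by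
  have hK : IsCompact ((bdry m₁ m₂ \ U) ×ˢ Icc (0 : ℝ) 1) :=
    ((isCompact_bdry hm₁ hm₂).diff hU).prod isCompact_Icc
  have hcont : Continuous fun p : (ℂ × ℂ) × ℝ => ‖w m₁ m₂ p.1 (p.2 • z)‖ :=
    (continuous_w_comp hm₁ hm₂ continuous_fst (by fun_prop)).norm
  have hpos : ∀ p ∈ ((bdry m₁ m₂ \ U) ×ˢ Icc (0 : ℝ) 1), 0 < ‖w m₁ m₂ p.1 (p.2 • z)‖ := by
    rintro ⟨ξ, r⟩ ⟨⟨h1, h2⟩, h3⟩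
    have hz1 : rho m₁ m₂ z = 1 := hz
    have hle := rho_smul_le hm₁ hm₂ h3.1 h3.2 z
    rw [hz1, mul_one] at hle
    refine norm_pos_iff.2 (w_ne_zero hm₁ hm₂ h1 (hle.trans h3.2) fun heq => ?_)
    have hξ : rho m₁ m₂ ξ = 1 := h1
    simp only at heq
    rw [← heq] at hξ
    have : r = 1 := le_antisymm h3.2 (by linarith)
    rw [this, one_smul] at heq
    exact h2 (heq ▸ hzU)
  obtain ⟨η, h1, h2⟩ := hK.exists_forall_le' hcont.continuousOn hpos
  exact ⟨η, h1, fun ξ hξ hξU r hr => h2 (ξ, r) ⟨⟨hξ, hξU⟩, hr⟩⟩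

/-- The first part is a dominating function uniform up to and including `r = 1`; the second makes
the integrand converge pointwise. -/
lemma exists_norm_div_w_sq_le {m₁ m₂ : ℝ} (hm₁ : 1 ≤ m₁) (hm₂ : 1 ≤ m₂) {f : ℂ × ℂ → ℂ}
    {z : ℂ × ℂ} (hz : z ∈ bdry m₁ m₂) (h0 : ∀ᶠ ξ in 𝓝[bdry m₁ m₂] z, f ξ = 0) :
    ∃ C : ℝ, (∀ ξ ∈ bdry m₁ m₂, ∀ r ∈ Icc (0 : ℝ) 1,
      ‖f ξ / (w m₁ m₂ ξ (r • z)) ^ 2‖ ≤ C * ‖f ξ‖) ∧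
      ∀ ξ ∈ bdry m₁ m₂, f ξ = 0 ∨ w m₁ m₂ ξ z ≠ 0 := by
  obtain ⟨U, hUo, hzU, hU⟩ := mem_nhdsWithin.1 h0
  obtain ⟨η, hη, h⟩ := exists_le_norm_w hm₁ hm₂ hz hUo hzU
  refine ⟨1 / η ^ 2, fun ξ hξ r hr => ?_, fun ξ hξ => ?_⟩
  · by_cases hξU : ξ ∈ U
    · have h1 : f ξ = 0 := hU ⟨hξU, hξ⟩
      rw [h1, zero_div, norm_zero, mul_zero]
    · exact norm_div_sq_le hη (h ξ hξ hξU r hr) _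
  · by_cases hξU : ξ ∈ U
    · exact Or.inl (hU ⟨hξU, hξ⟩)
    · have h1 := h ξ hξ hξU 1 (by simp)
      rw [one_smul] at h1
      exact Or.inr (norm_pos_iff.1 (hη.trans_le h1))

lemma aestronglyMeasurable_div_w_sq {m₁ m₂ : ℝ} (hm₁ : 1 ≤ m₁) (hm₂ : 1 ≤ m₂)
    {f : ℂ × ℂ → ℂ} (hf : Integrable f (lerayMeasure m₁ m₂)) (z : ℂ × ℂ) :
    AEStronglyMeasurable (fun ξ => f ξ / (w m₁ m₂ ξ z) ^ 2) (lerayMeasure m₁ m₂) := by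
  exact (hf.1.aemeasurable.div ((measurable_w hm₁ hm₂ z).pow_const 2).aemeasurable).aestronglyMeasurable

lemma integrable_div_w_sq {m₁ m₂ : ℝ} (hm₁ : 1 ≤ m₁) (hm₂ : 1 ≤ m₂) {f : ℂ × ℂ → ℂ}
    (hf : Integrable f (lerayMeasure m₁ m₂)) {z : ℂ × ℂ} (hz : z ∈ bdry m₁ m₂)
    (h0 : ∀ᶠ ξ in 𝓝[bdry m₁ m₂] z, f ξ = 0) :
    Integrable (fun ξ => f ξ / (w m₁ m₂ ξ z) ^ 2) (lerayMeasure m₁ m₂) := by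
  have : Fact (1 ≤ m₁) := ⟨hm₁⟩
  have : Fact (1 ≤ m₂) := ⟨hm₂⟩
  obtain ⟨C, hC, -⟩ := exists_norm_div_w_sq_le hm₁ hm₂ hz h0
  refine (hf.norm.const_mul C).mono' (aestronglyMeasurable_div_w_sq hm₁ hm₂ hf z) ?_
  filter_upwards [ae_mem_bdry m₁ m₂] with ξ hξ
  simpa using hC ξ hξ 1 (by simp)

lemma tendsto_cauchyLF_of_eventually_eq_zero {m₁ m₂ : ℝ} (hm₁ : 1 ≤ m₁) (hm₂ : 1 ≤ m₂)
    {f : ℂ × ℂ → ℂ} (hf : Integrable f (lerayMeasure m₁ m₂)) {z : ℂ × ℂ}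
    (hz : z ∈ bdry m₁ m₂) (h0 : ∀ᶠ ξ in 𝓝[bdry m₁ m₂] z, f ξ = 0) :
    Tendsto (fun r : ℝ => cauchyLF m₁ m₂ f (r • z)) (𝓝[<] 1) (𝓝 (cauchyLF m₁ m₂ f z)) := by
  have : Fact (1 ≤ m₁) := ⟨hm₁⟩
  have : Fact (1 ≤ m₂) := ⟨hm₂⟩
  obtain ⟨C, hC, hne⟩ := exists_norm_div_w_sq_le hm₁ hm₂ hz h0
  unfold cauchyLF
  refine Tendsto.const_mul _ ?_
  refine tendsto_integral_filter_of_dominated_convergence (fun ξ => C * ‖f ξ‖)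
    (Eventually.of_forall fun r => aestronglyMeasurable_div_w_sq hm₁ hm₂ hf _) ?_
    (hf.norm.const_mul C) ?_
  · have : ∀ᶠ r : ℝ in 𝓝[<] 1, r ∈ Ioo (0 : ℝ) 1 := Ioo_mem_nhdsLT zero_lt_one
    filter_upwards [this] with r hr
    filter_upwards [ae_mem_bdry m₁ m₂] with ξ hξ
    exact hC ξ hξ r ⟨hr.1.le, hr.2.le⟩
  · filter_upwards [ae_mem_bdry m₁ m₂] with ξ hξ
    rcases hne ξ hξ with h | h
    · simp [h]
    · have hc : Continuous fun r : ℝ => w m₁ m₂ ξ (r • z) :=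
        continuous_w_comp hm₁ hm₂ continuous_const (by fun_prop)
      have h1 : Tendsto (fun r : ℝ => w m₁ m₂ ξ (r • z)) (𝓝[<] 1) (𝓝 (w m₁ m₂ ξ z)) := by
        have := hc.tendsto 1
        rw [one_smul] at this
        exact this.mono_left nhdsWithin_le_nhds
      exact tendsto_const_nhds.div (h1.pow 2) (pow_ne_zero 2 h)

/-- The Cauchy–Leray–Fantappiè integral has a radial limit at each boundary point near which
the density is constant. -/
lemma exists_tendsto_cauchyLF_of_eventually_const {m₁ m₂ : ℝ} (hm₁ : 1 ≤ m₁) (hm₂ : 1 ≤ m₂)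
    {f : ℂ × ℂ → ℂ} (hf : Integrable f (lerayMeasure m₁ m₂)) {z : ℂ × ℂ}
    (hz : z ∈ bdry m₁ m₂) {c : ℂ} (h0 : ∀ᶠ ξ in 𝓝[bdry m₁ m₂] z, f ξ = c) :
    ∃ y, Tendsto (fun r : ℝ => cauchyLF m₁ m₂ f (r • z)) (𝓝[<] 1) (𝓝 y) := by
  have : Fact (1 ≤ m₁) := ⟨hm₁⟩
  have : Fact (1 ≤ m₂) := ⟨hm₂⟩
  -- Subtracting `c` gives a density vanishing near `z`, and the image of `c` is constant along the
  -- radius.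
  have hg : Integrable (fun ξ => f ξ - c) (lerayMeasure m₁ m₂) := hf.sub (integrable_const c)
  have h1 := tendsto_cauchyLF_of_eventually_eq_zero hm₁ hm₂ hg hz
    (h0.mono fun ξ h => by rw [h, sub_self])
  refine ⟨_, (h1.add_const (cauchyLF m₁ m₂ (fun _ => c) 0)).congr' ?_⟩
  have : ∀ᶠ r : ℝ in 𝓝[<] 1, r ∈ Ioo (0 : ℝ) 1 := Ioo_mem_nhdsLT zero_lt_one
  filter_upwards [this] with r hr
  have hz1 : rho m₁ m₂ z = 1 := hz
  have hle := rho_smul_le hm₁ hm₂ hr.1.le hr.2.le z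
  rw [hz1, mul_one] at hle
  have hlt : rho m₁ m₂ (r • z) < 1 := hle.trans_lt hr.2
  rw [← cauchyLF_const hm₁ hm₂ c hlt]
  have hb : ∀ g : ℂ × ℂ → ℂ, Integrable g (lerayMeasure m₁ m₂) →
      Integrable (fun ξ => g ξ / (w m₁ m₂ ξ (r • z)) ^ 2) (lerayMeasure m₁ m₂) := by
    intro g hg
    refine (hg.norm.const_mul (1 / ((1 - rho m₁ m₂ (r • z)) / 2) ^ 2)).mono'
      (aestronglyMeasurable_div_w_sq hm₁ hm₂ hg _) ?_
    filter_upwards [ae_mem_bdry m₁ m₂] with ξ hξ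
    have h2 := (le_w_re hm₁ hm₂ hξ (r • z)).trans (Complex.re_le_norm _)
    have h3 : 0 < (1 - rho m₁ m₂ (r • z)) / 2 := by linarith
    exact norm_div_sq_le h3 h2 _
  rw [cauchyLF, cauchyLF, cauchyLF, ← mul_add, ← integral_add (hb _ hg) (hb _ (integrable_const c))]
  simp only [← add_div, sub_add_cancel]

/-! ### The kernel between opposite patches -/

lemma star_mul_eq_polar (ξ z : ℂ) :
    star ξ * z = ((‖ξ‖ * ‖z‖ : ℝ) : ℂ) *
      Complex.exp (((z.arg - ξ.arg : ℝ) : ℂ) * Complex.I) := by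
  nth_rewrite 1 [← Complex.norm_mul_exp_arg_mul_I ξ, ← Complex.norm_mul_exp_arg_mul_I z]
  rw [star_mul', Complex.star_def, Complex.conj_ofReal, ← Complex.exp_conj]
  have : Complex.exp (((z.arg - ξ.arg : ℝ) : ℂ) * Complex.I)
      = Complex.exp ((starRingEnd ℂ) (ξ.arg * Complex.I)) * Complex.exp (z.arg * Complex.I) := by
    rw [← Complex.exp_add]; congr 1; simp; ring
  rw [this]; push_cast; ring

lemma star_mul_re (ξ z : ℂ) : (star ξ * z).re = ‖ξ‖ * ‖z‖ * cos (z.arg - ξ.arg) := by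
  rw [star_mul_eq_polar, Complex.re_ofReal_mul, Complex.exp_ofReal_mul_I_re]

lemma star_mul_im (ξ z : ℂ) : (star ξ * z).im = ‖ξ‖ * ‖z‖ * sin (z.arg - ξ.arg) := by
  rw [star_mul_eq_polar, Complex.im_ofReal_mul, Complex.exp_ofReal_mul_I_im]

/-- A crude bound that lets the first coordinate be treated as a perturbation of the second. -/
lemma norm_wCoord_le {m : ℝ} (hm : 1 ≤ m) (ξ z : ℂ) :
    ‖wCoord m ξ z‖ ≤ 2 * m * ‖ξ‖ ^ (2 * m) + ‖z‖ ^ (2 * m) / 2 := by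
  rw [wCoord_eq hm]
  refine (norm_sub_le _ _).trans ?_
  have h1 := mul_rpow_mul_le hm (norm_nonneg ξ) (norm_nonneg z)
  have h2 : 0 ≤ ‖ξ‖ ^ (2 * m) := by positivity
  rw [norm_mul, norm_mul, norm_star, Complex.norm_real, Complex.norm_real,
    norm_of_nonneg (by positivity), norm_of_nonneg (by positivity)]
  linarith

lemma bdry_norm_snd {m₁ m₂ : ℝ} {ξ : ℂ × ℂ} (hξ : ξ ∈ bdry m₁ m₂) :
    ‖ξ.2‖ ^ (2 * m₂) = 1 - ‖ξ.1‖ ^ (2 * m₁) := by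
  have h : ‖ξ.1‖ ^ (2 * m₁) + ‖ξ.2‖ ^ (2 * m₂) = 1 := hξ
  linarith

lemma le_one_of_rpow_le_one {m R : ℝ} (hm : 1 ≤ m) (h : R ^ (2 * m) ≤ 1) : R ≤ 1 := by
  by_contra! hc
  have := one_lt_rpow hc (by linarith : 0 < 2 * m)
  linarith

lemma rpow_le_self {m R : ℝ} (hm : 1 ≤ m) (hR : 0 ≤ R) (h : R ≤ 1) : R ^ (2 * m) ≤ R := by
  rcases hR.eq_or_lt with rfl | h0
  · rw [zero_rpow (by linarith : 2 * m ≠ 0)]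
  · calc R ^ (2 * m) ≤ R ^ (1 : ℝ) := rpow_le_rpow_of_exponent_ge h0 h (by linarith)
      _ = R := rpow_one R

/-- If `θ₂(ξ) < 0 < θ₂(z)` dominate `|ξ₁|^(2 m₁)` and `|z₁|^(2 m₁)`, then `w(ξ,z)` is close to
the negative imaginary axis. -/
lemma w_bounds {m₁ m₂ : ℝ} (hm₁ : 1 ≤ m₁) (hm₂ : 1 ≤ m₂) {α β : ℝ} (hα : 0 < α) (hβ : 0 < β)
    (hα' : α ≤ 1 / 200) (hβ' : β ≤ 1 / 200) {ξ z : ℂ × ℂ} (hξ : ξ ∈ bdry m₁ m₂)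
    (hz : z ∈ bdry m₁ m₂) (hξa : ξ.2.arg ∈ Icc (-2 * β) (-β)) (hza : z.2.arg ∈ Icc α (2 * α))
    (hξ1 : ‖ξ.1‖ ^ (2 * m₁) ≤ 1 / (100 * m₁) * β) (hz1 : ‖z.1‖ ^ (2 * m₁) ≤ 1 / (100 * m₁) * α) :
    |(w m₁ m₂ ξ z).re| ≤ 6 / 100 * (m₂ * (α + β)) ∧
      4 / 10 * (m₂ * (α + β)) ≤ -(w m₁ m₂ ξ z).im ∧ -(w m₁ m₂ ξ z).im ≤ 3 * (m₂ * (α + β)) := by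
  have hσ0 : 0 ≤ ‖ξ.1‖ ^ (2 * m₁) := by positivity
  have hτ0 : 0 ≤ ‖z.1‖ ^ (2 * m₁) := by positivity
  have hξ2 := bdry_norm_snd hξ
  have hz2 := bdry_norm_snd hz
  have n1 := norm_wCoord_le hm₁ ξ.1 z.1
  -- Convexity supplies the lower bound `(τ - σ)/2` for the real part; the explicit formula `r2`
  -- supplies the upper bound.
  have l2 := le_wCoord_re hm₂ ξ.2 z.2
  have r2 := wCoord_re hm₂ ξ.2 z.2
  have i2 := wCoord_im hm₂ ξ.2 z.2
  rw [star_mul_re] at r2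
  rw [star_mul_im] at i2
  have hsq := rpow_two_mul_sub_one_mul_sq hm₂ (norm_nonneg ξ.2)
  set σ := ‖ξ.1‖ ^ (2 * m₁)
  set τ := ‖z.1‖ ^ (2 * m₁)
  set x := z.2.arg - ξ.2.arg with hx
  have hx1 : α + β ≤ x := by rw [hx]; linarith [hza.1, hξa.2]
  have hx2 : x ≤ 2 * (α + β) := by rw [hx]; linarith [hza.2, hξa.1]
  -- The factor `1/(100 m₁)` in the patches is chosen so that the first coordinate stays small
  -- against `m₂ (α + β)`, uniformly in `m₁`.
  have hσ : m₁ * σ ≤ β / 100 := by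
    have := mul_le_mul_of_nonneg_left hξ1 (by linarith : 0 ≤ m₁)
    calc m₁ * σ ≤ m₁ * (1 / (100 * m₁) * β) := this
      _ = β / 100 := by field_simp
  have hτ : m₁ * τ ≤ α / 100 := by
    have := mul_le_mul_of_nonneg_left hz1 (by linarith : 0 ≤ m₁)
    calc m₁ * τ ≤ m₁ * (1 / (100 * m₁) * α) := this
      _ = α / 100 := by field_simp
  have hσ' : σ ≤ β / 100 := (le_mul_of_one_le_left hσ0 hm₁).trans hσ
  have hτ' : τ ≤ α / 100 := (le_mul_of_one_le_left hτ0 hm₁).trans hτ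
  set R := ‖ξ.2‖
  set P := ‖z.2‖
  have hR0 : 0 ≤ R := norm_nonneg _
  have hP0 : 0 ≤ P := norm_nonneg _
  have hR1 : R ≤ 1 := le_one_of_rpow_le_one hm₂ (by linarith)
  have hP1 : P ≤ 1 := le_one_of_rpow_le_one hm₂ (by linarith)
  have hPl : 1 - τ ≤ P := hz2 ▸ rpow_le_self hm₂ hP0 hP1
  have hy0 : 0 ≤ R ^ (2 * (m₂ - 1)) := by positivity
  have hy1 : R ^ (2 * (m₂ - 1)) ≤ 1 := rpow_le_one hR0 hR1 (by linarith)
  set y := R ^ (2 * (m₂ - 1))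
  rw [hξ2] at hsq
  -- The second coordinate of `w` is `m₂ ((1 - σ) - K e^{ix})`, where `K` lies within `σ + τ` of
  -- `1`.
  set K := y * (R * P) with hK
  have hyR : 1 - σ ≤ y * R := by
    rw [← hsq, sq, ← mul_assoc]
    exact mul_le_of_le_one_right (mul_nonneg hy0 hR0) hR1
  have hyR1 : y * R ≤ 1 := mul_le_one₀ hy1 hR0 hR1
  have hKl : 1 - σ - τ ≤ K := by
    have : K = (y * R) * P := by rw [hK]; ring
    have h1 : (1 - σ) * (1 - τ) ≤ (y * R) * P :=
      mul_le_mul hyR hPl (by linarith) (mul_nonneg hy0 hR0)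
    linarith [mul_nonneg hσ0 hτ0]
  have hKu : K ≤ 1 := by
    have : K = (y * R) * P := by rw [hK]; ring
    rw [this]
    exact mul_le_one₀ hyR1 hP0 hP1
  have hK0 : 99 / 100 ≤ K := by linarith
  have hsin1 : 6 / 10 * x ≤ sin x := by
    have h1 := mul_le_sin (by linarith : 0 ≤ x) (by linarith [pi_gt_three])
    have h2 : 6 / 10 ≤ 2 / π := by rw [le_div_iff₀ pi_pos]; linarith [pi_lt_d2]
    have h3 : 6 / 10 * x ≤ 2 / π * x := by gcongr; linarith
    linarith
  have hsin2 : sin x ≤ x := sin_le (by linarith)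
  have hcos := one_sub_sq_div_two_le_cos (x := x)
  have hx3 : x ^ 2 / 2 ≤ (α + β) / 50 := by
    have h1 : x ^ 2 ≤ (2 * (α + β)) ^ 2 := pow_le_pow_left₀ (by linarith) hx2 2
    have h2 : (α + β) * (α + β) ≤ 1 / 100 * (α + β) := by
      gcongr
      linarith
    linarith
  have hr2 : (wCoord m₂ ξ.2 z.2).re ≤ m₂ * (3 / 100 * (α + β)) := by
    rw [r2, hξ2]
    have h1 : K * (1 - x ^ 2 / 2) ≤ K * cos x := mul_le_mul_of_nonneg_left hcos (by linarith)
    have h2 : (1 - σ) - K * cos x ≤ 3 / 100 * (α + β) := by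
      have h3 : K * (x ^ 2 / 2) ≤ 1 * (x ^ 2 / 2) := by gcongr
      linarith
    have := mul_le_mul_of_nonneg_left h2 (by linarith : 0 ≤ m₂)
    calc _ = m₂ * ((1 - σ) - K * cos x) := by rw [hK]; ring
      _ ≤ _ := this
  have hi2 : (wCoord m₂ ξ.2 z.2).im = -(m₂ * (K * sin x)) := by rw [i2, hK]; ring
  have hi3 : m₂ * (5 / 10 * (α + β)) ≤ m₂ * (K * sin x) := by
    refine mul_le_mul_of_nonneg_left ?_ (by linarith)
    have : 99 / 100 * (6 / 10 * x) ≤ K * sin x :=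
      mul_le_mul hK0 hsin1 (by linarith) (by linarith)
    linarith
  have hi4 : m₂ * (K * sin x) ≤ m₂ * (2 * (α + β)) := by
    refine mul_le_mul_of_nonneg_left ?_ (by linarith)
    have : K * sin x ≤ 1 * x := mul_le_mul hKu hsin2 (by linarith) zero_le_one
    linarith
  have hD : α + β ≤ m₂ * (α + β) := le_mul_of_one_le_left (by linarith) hm₂
  have hre := (Complex.abs_re_le_norm (wCoord m₁ ξ.1 z.1)).trans n1
  have him := (Complex.abs_im_le_norm (wCoord m₁ ξ.1 z.1)).trans n1
  rw [abs_le] at hre him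
  rw [hξ2, hz2] at l2
  rw [w_eq, Complex.add_re, Complex.add_im, abs_le, hi2]
  refine ⟨⟨?_, ?_⟩, ?_, ?_⟩
  · linarith [hre.1]
  · linarith [hre.2]
  · linarith [him.2]
  · linarith [him.1]

/-- Here `-Re(1/v²) = (Im² - Re²)/|v|⁴`, with numerator at least `0.15 D²` and `|v|² ≤ 10 D²`. -/
lemma le_neg_one_div_sq_re {D : ℝ} (hD : 0 < D) {v : ℂ} (h1 : |v.re| ≤ 6 / 100 * D)
    (h2 : 4 / 10 * D ≤ -v.im) (h3 : -v.im ≤ 3 * D) :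
    1 / (1000 * D ^ 2) ≤ -(1 / v ^ 2).re := by
  have e1 : v.re ^ 2 ≤ (6 / 100 * D) ^ 2 := sq_le_sq' (abs_le.1 h1).1 (abs_le.1 h1).2
  have e2 : (4 / 10 * D) ^ 2 ≤ v.im ^ 2 := by nlinarith
  have e3 : v.im ^ 2 ≤ (3 * D) ^ 2 := by nlinarith
  have hN : 0 < Complex.normSq v := by
    rw [Complex.normSq_apply]; nlinarith [sq_nonneg v.re, sq_pos_of_pos hD]
  have hN2 : Complex.normSq v ≤ 10 * D ^ 2 := by
    rw [Complex.normSq_apply]; nlinarith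
  have : -(1 / v ^ 2).re = (v.im ^ 2 - v.re ^ 2) / Complex.normSq v ^ 2 := by
    rw [one_div, Complex.inv_re, map_pow, sq v, Complex.mul_re]
    ring
  rw [this, div_le_div_iff₀ (by positivity) (by positivity)]
  have h4 : Complex.normSq v ^ 2 ≤ (10 * D ^ 2) ^ 2 := by gcongr
  have h5 : 15 / 100 * D ^ 2 ≤ v.im ^ 2 - v.re ^ 2 := by nlinarith
  have h6 := mul_le_mul_of_nonneg_right h5 (by positivity : 0 ≤ 1000 * D ^ 2)
  nlinarith

/-! ### The test function and its local constancy -/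

lemma patch_eq_box (m₁ m₂ γ₁ γ₂ α : ℝ) : patch m₁ m₂ γ₁ γ₂ α
    = box m₁ m₂ (Icc (-(π / 12)) 0) (Icc (-2 * α) (-α)) (Icc (γ₁ * α) (γ₂ * α)) := rfl

lemma measurableSet_patch (m₁ m₂ γ₁ γ₂ α : ℝ) : MeasurableSet (patch m₁ m₂ γ₁ γ₂ α) := by
  rw [patch_eq_box]
  exact measurableSet_box _ _ measurableSet_Icc measurableSet_Icc measurableSet_Icc

section Sequence

variable {a : ℕ → ℝ}

lemma two_mul_le_of_lt (ha : ∀ k, 0 < a k) (hh : ∀ k, 2 * a (k + 1) ≤ a k) {j k : ℕ}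
    (hjk : j < k) : 2 * a k ≤ a j := by
  have hanti : Antitone a := antitone_nat_of_succ_le fun n => by linarith [hh n, ha (n + 1)]
  linarith [hh j, hanti (Nat.succ_le_of_lt hjk)]

lemma tendsto_zero_of_halving (ha : ∀ k, 0 < a k) (hh : ∀ k, 2 * a (k + 1) ≤ a k) :
    Tendsto a atTop (𝓝 0) := by
  have hle : ∀ k, a k ≤ a 0 * (1 / 2) ^ k := by
    intro k
    induction k with
    | zero => simp
    | succ k ih => rw [pow_succ]; linarith [hh k]
  have h := (tendsto_pow_atTop_nhds_zero_of_lt_one (by norm_num : (0 : ℝ) ≤ 1 / 2)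
    (by norm_num)).const_mul (a 0)
  rw [mul_zero] at h
  exact squeeze_zero (fun k => (ha k).le) hle h

variable {m₁ m₂ γ₁ γ₂ p₀ : ℝ} {ψ : ℝ → ℝ}

/-- Halving makes the intervals `[-2aₖ, -aₖ]` meet at most at an endpoint, and such an endpoint is
some `-aⱼ`. -/
lemma patch_unique (ha : ∀ k, 0 < a k) (hh : ∀ k, 2 * a (k + 1) ≤ a k) {ξ : ℂ × ℂ}
    (hξ : ∀ k, ξ.2.arg ≠ -a k) {j k : ℕ} (hj : ξ ∈ patch m₁ m₂ γ₁ γ₂ (a j))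
    (hk : ξ ∈ patch m₁ m₂ γ₁ γ₂ (a k)) : j = k := by
  have key : ∀ {j k : ℕ}, j < k → ξ ∈ patch m₁ m₂ γ₁ γ₂ (a j) →
      ξ ∈ patch m₁ m₂ γ₁ γ₂ (a k) → False := by
    intro j k hjk hj hk
    have h1 := two_mul_le_of_lt ha hh hjk
    have h2 := lt_of_le_of_ne hj.2.2.1.2 (hξ j)
    linarith [hk.2.2.1.1]
  rcases lt_trichotomy j k with h | h | h
  · exact (key h hj hk).elim
  · exact h
  · exact (key h hk hj).elim

lemma testFun_cases (ha : ∀ k, 0 < a k) (hh : ∀ k, 2 * a (k + 1) ≤ a k) {ξ : ℂ × ℂ}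
    (hξ : ∀ k, ξ.2.arg ≠ -a k) :
    (testFun m₁ m₂ γ₁ γ₂ p₀ ψ a ξ = 0 ∧ ∀ k, ξ ∉ patch m₁ m₂ γ₁ γ₂ (a k)) ∨
      ∃ k, ξ ∈ patch m₁ m₂ γ₁ γ₂ (a k) ∧
        testFun m₁ m₂ γ₁ γ₂ p₀ ψ a ξ = (coeff p₀ ψ (a k) : ℂ) ∧
        ∀ j, j ≠ k → ξ ∉ patch m₁ m₂ γ₁ γ₂ (a j) := by
  by_cases h : ∃ k, ξ ∈ patch m₁ m₂ γ₁ γ₂ (a k)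
  · obtain ⟨k, hk⟩ := h
    have hne : ∀ j, j ≠ k → ξ ∉ patch m₁ m₂ γ₁ γ₂ (a j) :=
      fun j hj hc => hj (patch_unique ha hh hξ hc hk)
    refine Or.inr ⟨k, hk, ?_, hne⟩
    rw [testFun, tsum_eq_single k fun j hj => indicator_of_notMem (hne j hj) _,
      indicator_of_mem hk]
  · push Not at h
    refine Or.inl ⟨?_, h⟩
    simp only [testFun, indicator_of_notMem (h _), tsum_zero]

lemma testFun_eq_zero (ha : ∀ k, 0 < a k) {ξ : ℂ × ℂ} (hξ : 0 < ξ.2.arg) :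
    testFun m₁ m₂ γ₁ γ₂ p₀ ψ a ξ = 0 := by
  have h : ∀ k, ξ ∉ patch m₁ m₂ γ₁ γ₂ (a k) := by
    intro k hk
    linarith [hk.2.2.1.2, ha k]
  simp only [testFun, indicator_of_notMem (h _), tsum_zero]

lemma ae_arg_ne [Fact (1 ≤ m₁)] [Fact (1 ≤ m₂)] (a : ℕ → ℝ) :
    ∀ᵐ ξ ∂(lerayMeasure m₁ m₂), ∀ k, ξ.2.arg ≠ -a k := by
  filter_upwards [ae_mem_box_compl m₁ m₂ (countable_range fun k => -a k)] with ξ hξ k hk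
  exact hξ.2.2.1 ⟨k, hk.symm⟩

lemma measurable_testFun : Measurable (testFun m₁ m₂ γ₁ γ₂ p₀ ψ a) :=
  Measurable.tsum fun _ => measurable_const.indicator (measurableSet_patch ..)

lemma eventually_mem_Icc_iff {X : Type*} {l : Filter X} {u : X → ℝ} {x c d : ℝ}
    (hu : Tendsto u l (𝓝 x)) (hc : x ≠ c) (hd : x ≠ d) :
    ∀ᶠ y in l, (u y ∈ Icc c d ↔ x ∈ Icc c d) := by
  by_cases h : x ∈ Icc c d
  · have h1 : c < x := lt_of_le_of_ne h.1 hc.symm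
    have h2 : x < d := lt_of_le_of_ne h.2 hd
    filter_upwards [hu (Icc_mem_nhds h1 h2)] with y hy
    exact ⟨fun _ => h, fun _ => hy⟩
  · filter_upwards [hu (isClosed_Icc.isOpen_compl.mem_nhds h)] with y hy
    exact ⟨fun h' => absurd h' hy, fun h' => absurd h' h⟩

lemma tendsto_arg_comp {X : Type*} {l : Filter X} {u : X → ℂ} {x : ℂ} (hu : Tendsto u l (𝓝 x))
    (h0 : x.arg ≠ 0) (hπ : x.arg ≠ π) : Tendsto (fun y => (u y).arg) l (𝓝 x.arg) := by
  -- Since `arg 0 = 0` by convention, excluding the argument `0` also excludes the origin.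
  have hx : x ∈ Complex.slitPlane :=
    Complex.mem_slitPlane_iff_arg.2 ⟨hπ, fun h => h0 (by rw [h, Complex.arg_zero])⟩
  exact (Complex.continuousAt_arg hx).tendsto.comp hu

/-- The exceptional values of the coordinates, off which the test function is locally constant. -/
def exceptional (γ₁ γ₂ : ℝ) (a : ℕ → ℝ) : Set ℝ :=
  {0, π, -(π / 12)} ∪ (range (fun k => -a k) ∪ range (fun k => -2 * a k) ∪
    (range (fun k => γ₁ * a k) ∪ range fun k => γ₂ * a k))

lemma countable_exceptional (γ₁ γ₂ : ℝ) (a : ℕ → ℝ) : (exceptional γ₁ γ₂ a).Countable :=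
  (Set.toFinite _).countable.union (((countable_range _).union (countable_range _)).union
    ((countable_range _).union (countable_range _)))

/-- Each indicator is locally constant off the edges of its patch. Because `θ₂(z) ≠ 0` and `aₖ → 0`,
only finitely many patches come near `z`, so one neighbourhood serves them all. -/
lemma eventually_testFun_eq (hm₁ : 1 ≤ m₁) (ha : ∀ k, 0 < a k) (hh : ∀ k, 2 * a (k + 1) ≤ a k)
    {z : ℂ × ℂ} (hz : z ∈ box m₁ m₂ (exceptional γ₁ γ₂ a)ᶜ (exceptional γ₁ γ₂ a)ᶜ
      (exceptional γ₁ γ₂ a)ᶜ) :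
    ∀ᶠ ξ in 𝓝[bdry m₁ m₂] z,
      testFun m₁ m₂ γ₁ γ₂ p₀ ψ a ξ = testFun m₁ m₂ γ₁ γ₂ p₀ ψ a z := by
  obtain ⟨hzb, hz1, hz2, hz3⟩ := hz
  have hid : Tendsto (fun ξ : ℂ × ℂ => ξ) (𝓝[bdry m₁ m₂] z) (𝓝 z) := nhdsWithin_le_nhds
  have hne : ∀ x ∉ exceptional γ₁ γ₂ a, x ≠ 0 ∧ x ≠ π ∧ x ≠ -(π / 12) ∧ ∀ k,
      x ≠ -a k ∧ x ≠ -2 * a k ∧ x ≠ γ₁ * a k ∧ x ≠ γ₂ * a k := by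
    intro x hx
    simp only [exceptional, mem_union, mem_insert_iff, mem_singleton_iff, mem_range, not_or,
      not_exists] at hx
    obtain ⟨⟨h1, h2, h3⟩, ⟨h4, h5⟩, h6, h7⟩ := hx
    exact ⟨h1, h2, h3, fun k => ⟨fun h => h4 k h.symm, fun h => h5 k h.symm,
      fun h => h6 k h.symm, fun h => h7 k h.symm⟩⟩
  obtain ⟨e0, eπ, e12, -⟩ := hne _ hz1
  obtain ⟨f0, fπ, -, fk⟩ := hne _ hz2
  obtain ⟨-, -, -, gk⟩ := hne _ hz3
  have t1 := tendsto_arg_comp ((continuous_fst.tendsto z).comp hid) e0 eπ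
  have t2 := tendsto_arg_comp ((continuous_snd.tendsto z).comp hid) f0 fπ
  have hc : Continuous fun ξ : ℂ × ℂ => ‖ξ.1‖ ^ (2 * m₁) :=
    continuous_fst.norm.rpow_const fun _ => Or.inr (by linarith)
  have t3 := (hc.tendsto z).comp hid
  have hpatch : ∀ k, ∀ᶠ ξ in 𝓝[bdry m₁ m₂] z,
      (ξ ∈ patch m₁ m₂ γ₁ γ₂ (a k) ↔ z ∈ patch m₁ m₂ γ₁ γ₂ (a k)) := by
    intro k
    filter_upwards [eventually_mem_Icc_iff t1 e12 e0,
      eventually_mem_Icc_iff t2 (fk k).2.1 (fk k).1,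
      eventually_mem_Icc_iff t3 (gk k).2.2.1 (gk k).2.2.2, self_mem_nhdsWithin] with ξ i1 i2 i3 i4
    exact and_congr (iff_of_true i4 hzb) (and_congr i1 (and_congr i2 i3))
  have hpos : 0 < |z.2.arg| / 2 := by have := abs_pos.2 f0; positivity
  have hlarge : ∀ᶠ ξ in 𝓝[bdry m₁ m₂] z, |z.2.arg| / 2 < |ξ.2.arg| :=
    t2.abs.eventually (lt_mem_nhds (by linarith))
  -- From `N` on, `aₖ < |θ₂(z)|/4`, so these patches lie in `|θ₂| < |θ₂(z)|/2`.
  obtain ⟨N, hN⟩ := ((tendsto_zero_of_halving ha hh).eventually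
    (gt_mem_nhds (half_pos hpos))).exists_forall_of_atTop
  have hfar : ∀ ξ : ℂ × ℂ, |z.2.arg| / 2 < |ξ.2.arg| → ∀ k ≥ N,
      ξ ∉ patch m₁ m₂ γ₁ γ₂ (a k) := by
    intro ξ hξ k hk hmem
    have h1 := hN k hk
    have h2 : |ξ.2.arg| ≤ 2 * a k :=
      abs_le.2 ⟨by linarith [hmem.2.2.1.1], by linarith [hmem.2.2.1.2, ha k]⟩
    linarith
  have hsum : ∀ ξ : ℂ × ℂ, |z.2.arg| / 2 < |ξ.2.arg| → testFun m₁ m₂ γ₁ γ₂ p₀ ψ a ξ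
      = ∑ k ∈ Finset.range N, (patch m₁ m₂ γ₁ γ₂ (a k)).indicator
        (fun _ => (coeff p₀ ψ (a k) : ℂ)) ξ := by
    intro ξ hξ
    refine tsum_eq_sum fun k hk => indicator_of_notMem (hfar ξ hξ k ?_) _
    simpa using hk
  have hall : ∀ᶠ ξ in 𝓝[bdry m₁ m₂] z, ∀ k ∈ Finset.range N,
      (ξ ∈ patch m₁ m₂ γ₁ γ₂ (a k) ↔ z ∈ patch m₁ m₂ γ₁ γ₂ (a k)) :=
    (Finset.eventually_all _).2 fun k _ => hpatch k
  filter_upwards [hlarge, hall] with ξ h1 h2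
  rw [hsum ξ h1, hsum z (by linarith)]
  refine Finset.sum_congr rfl fun k hk => ?_
  by_cases h3 : z ∈ patch m₁ m₂ γ₁ γ₂ (a k)
  · rw [indicator_of_mem h3, indicator_of_mem ((h2 k hk).2 h3)]
  · rw [indicator_of_notMem h3, indicator_of_notMem fun h => h3 ((h2 k hk).1 h)]

/-- Choose the radial limit wherever it exists and `0` elsewhere; the latter happens only on a null
set. -/
lemma exists_isImage_testFun (hm₁ : 1 ≤ m₁) (hm₂ : 1 ≤ m₂) (ha : ∀ k, 0 < a k)
    (hh : ∀ k, 2 * a (k + 1) ≤ a k)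
    (hint : Integrable (testFun m₁ m₂ γ₁ γ₂ p₀ ψ a) (lerayMeasure m₁ m₂)) :
    ∃ g, IsImage m₁ m₂ (testFun m₁ m₂ γ₁ γ₂ p₀ ψ a) g := by
  have : Fact (1 ≤ m₁) := ⟨hm₁⟩
  have : Fact (1 ≤ m₂) := ⟨hm₂⟩
  classical
  refine ⟨fun z => if h : ∃ y, Tendsto (fun r : ℝ =>
    cauchyLF m₁ m₂ (testFun m₁ m₂ γ₁ γ₂ p₀ ψ a) (r • z)) (𝓝[<] 1) (𝓝 y) then h.choose else 0, ?_⟩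
  filter_upwards [ae_mem_box_compl m₁ m₂ (countable_exceptional γ₁ γ₂ a)] with z hz
  have h := exists_tendsto_cauchyLF_of_eventually_const hm₁ hm₂ hint hz.1
    (eventually_testFun_eq hm₁ ha hh hz)
  rw [dif_pos h]
  exact h.choose_spec

end Sequence

section

/-! ### Modulars of the test function and of its image -/

/-- The area is quadratic in `α`, which exactly balances the size `α⁻²` of the kernel. -/
lemma lerayMeasure_patch {m₁ m₂ : ℝ} (hm₁ : 1 ≤ m₁) (hm₂ : 1 ≤ m₂) {α : ℝ} (h0 : 0 < α)
    (h1 : α ≤ 1 / 200) :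
    lerayMeasure m₁ m₂ (patch m₁ m₂ (1 / (200 * m₁)) (1 / (100 * m₁)) α)
      = ENNReal.ofReal (m₂ * π / 2400 * α ^ 2) := by
  have hm : 1 / (100 * m₁) ≤ 1 / 100 := one_div_le_one_div_of_le (by norm_num) (by linarith)
  have hle : 1 / (200 * m₁) ≤ 1 / (100 * m₁) :=
    one_div_le_one_div_of_le (by positivity) (by linarith)
  rw [patch_eq_box, lerayMeasure_box hm₁ hm₂ measurableSet_Icc measurableSet_Icc, Real.volume_Icc,
    Real.volume_Icc, ← ENNReal.ofReal_mul (by linarith [pi_pos]), ← ENNReal.ofReal_mul]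
  · congr 1; field_simp; ring
  · have : 0 ≤ m₂ := by linarith
    have : 1 / (200 * m₁) * α ≤ 1 / (100 * m₁) * α := by gcongr
    have : 0 ≤ 1 / (100 * m₁) * α - 1 / (200 * m₁) * α := by linarith
    positivity
  · exact fun x hx => ⟨by linarith [hx.1, pi_pos], by linarith [hx.2, pi_pos]⟩
  · exact fun x hx => ⟨by linarith [hx.1, pi_gt_three], by linarith [hx.2, pi_pos]⟩
  · positivity
  · gcongr
  · have : 1 / (100 * m₁) * α ≤ 1 / 100 * (1 / 200) := by gcongr
    linarith

/-- The patch on the other side of `θ₂ = 0`, where the image of the test function is large. -/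
def oppositePatch (m₁ m₂ α : ℝ) : Set (ℂ × ℂ) :=
  box m₁ m₂ (Ioc (-π) π) (Ioo α (2 * α)) (Icc (1 / (200 * m₁) * α) (1 / (100 * m₁) * α))

lemma lerayMeasure_oppositePatch {m₁ m₂ : ℝ} (hm₁ : 1 ≤ m₁) (hm₂ : 1 ≤ m₂) {α : ℝ} (h0 : 0 < α)
    (h1 : α ≤ 1 / 200) :
    lerayMeasure m₁ m₂ (oppositePatch m₁ m₂ α) = ENNReal.ofReal (m₂ * π / 100 * α ^ 2) := by
  have hm : 1 / (100 * m₁) ≤ 1 / 100 := one_div_le_one_div_of_le (by norm_num) (by linarith)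
  have hle : 1 / (200 * m₁) ≤ 1 / (100 * m₁) :=
    one_div_le_one_div_of_le (by positivity) (by linarith)
  rw [oppositePatch, lerayMeasure_box hm₁ hm₂ measurableSet_Ioc measurableSet_Ioo,
    Real.volume_Ioc, Real.volume_Ioo, ← ENNReal.ofReal_mul (by linarith [pi_pos]),
    ← ENNReal.ofReal_mul]
  · congr 1; field_simp; ring
  · have : 0 ≤ m₂ := by linarith
    have : 1 / (200 * m₁) * α ≤ 1 / (100 * m₁) * α := by gcongr
    have : 0 ≤ 1 / (100 * m₁) * α - 1 / (200 * m₁) * α := by linarith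
    positivity
  · rfl
  · exact fun x hx => ⟨by linarith [hx.1, pi_pos], by linarith [hx.2, pi_gt_three]⟩
  · positivity
  · gcongr
  · have : 1 / (100 * m₁) * α ≤ 1 / 100 * (1 / 200) := by gcongr
    linarith

/-- The test function of the sequence `a`, with the patch proportions used throughout. -/
abbrev testFun' (m₁ m₂ p₀ : ℝ) (ψ : ℝ → ℝ) (a : ℕ → ℝ) : ℂ × ℂ → ℂ :=
  testFun m₁ m₂ (1 / (200 * m₁)) (1 / (100 * m₁)) p₀ ψ a

variable {m₁ m₂ p₀ δ α₀ : ℝ} {ψ : ℝ → ℝ} {a : ℕ → ℝ}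

lemma nonneg_of_monotoneOn (hP : Profile p₀ ψ) (hmono : MonotoneOn ψ (Icc 0 δ)) {t : ℝ}
    (ht : t ∈ Icc 0 δ) : 0 ≤ ψ t := by
  have := hmono ⟨le_rfl, ht.1.trans ht.2⟩ ht ht.1
  rwa [hP.zero] at this

lemma one_le_coeff {α : ℝ} (h0 : 0 < α) (h1 : α ≤ 1) (hp : 0 < p₀ + ψ α) :
    1 ≤ coeff p₀ ψ α := by
  refine one_le_rpow_of_pos_of_le_one_of_nonpos h0 h1 ?_
  rw [neg_div]
  have : 0 < 2 / (p₀ + ψ α) := by positivity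
  linarith

lemma coeff_rpow {α : ℝ} (h0 : 0 < α) (hp : 0 < p₀ + ψ α) :
    coeff p₀ ψ α ^ (p₀ + ψ α) = (α ^ 2)⁻¹ := by
  rw [coeff, ← rpow_mul h0.le, div_mul_cancel₀ _ hp.ne', rpow_neg h0.le]
  norm_cast

/-- The left side is the `2p₀`-th power of the quantity controlled by the decay condition. -/
lemma coeff_rpow_mul_sq_le (hp₀ : 1 < p₀) {α : ℝ} (h0 : 0 < α) (hp : 0 < p₀ + ψ α) {k : ℕ}
    (hd : (1 / α) ^ (1 / (p₀ + ψ α) - 1 / p₀) ≤ (2 : ℝ) ^ (-((k : ℝ) + 1) / p₀)) :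
    coeff p₀ ψ α ^ p₀ * α ^ 2 ≤ (1 / 4) ^ k := by
  have hp0 : 0 < p₀ := by linarith
  have e1 : ((1 / α) ^ (1 / (p₀ + ψ α) - 1 / p₀)) ^ (2 * p₀) = coeff p₀ ψ α ^ p₀ * α ^ 2 := by
    rw [coeff, ← rpow_natCast α 2, ← rpow_mul h0.le, ← rpow_add h0, one_div, inv_rpow h0.le,
      ← rpow_neg h0.le, ← rpow_mul h0.le]
    congr 1
    push_cast
    field_simp
    ring
  have e2 : ((2 : ℝ) ^ (-((k : ℝ) + 1) / p₀)) ^ (2 * p₀) = (1 / 4) ^ (k + 1) := by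
    rw [← rpow_mul (by norm_num)]
    have : -((k : ℝ) + 1) / p₀ * (2 * p₀) = (-2) * ((k + 1 : ℕ) : ℝ) := by
      push_cast; field_simp
    rw [this, rpow_mul (by norm_num), rpow_natCast]
    congr 1
    rw [rpow_neg (by norm_num)]; norm_num
  rw [← e1]
  calc _ ≤ ((2 : ℝ) ^ (-((k : ℝ) + 1) / p₀)) ^ (2 * p₀) := by gcongr
    _ = (1 / 4) ^ (k + 1) := e2
    -- The sequence is indexed from `0`, so the decay condition gives exponent `k + 1`; the spare
    -- factor is dropped.
    _ ≤ (1 / 4) ^ k := pow_le_pow_of_le_one (by norm_num) (by norm_num) (Nat.le_succ k)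

/-- The integral of a power of the test function whose exponent is at most `p₀` on the patches
is finite. -/
lemma lintegral_testFun_rpow_lt_top (hm₁ : 1 ≤ m₁) (hm₂ : 1 ≤ m₂) (hP : Profile p₀ ψ)
    (ha : Admissible p₀ ψ α₀ a) (hα₀ : α₀ ≤ 1 / 200) (hpos : ∀ k, 0 ≤ ψ (a k))
    {q : ℂ × ℂ → ℝ} (hq0 : ∀ ξ, 0 < q ξ)
    (hq : ∀ k, ∀ ξ ∈ patch m₁ m₂ (1 / (200 * m₁)) (1 / (100 * m₁)) (a k), q ξ ≤ p₀) :
    ∫⁻ ξ, ENNReal.ofReal (‖testFun' m₁ m₂ p₀ ψ a ξ‖ ^ q ξ) ∂(lerayMeasure m₁ m₂) < ⊤ := by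
  have : Fact (1 ≤ m₁) := ⟨hm₁⟩
  have : Fact (1 ≤ m₂) := ⟨hm₂⟩
  have hp0 := hP.one_lt
  have hone : ∀ k, 1 ≤ coeff p₀ ψ (a k) := fun k =>
    one_le_coeff (ha.pos k) (by linarith [ha.lt k]) (by linarith [hpos k])
  have hle : ∫⁻ ξ, ENNReal.ofReal (‖testFun' m₁ m₂ p₀ ψ a ξ‖ ^ q ξ) ∂(lerayMeasure m₁ m₂)
      ≤ ∫⁻ ξ, ∑' k, (patch m₁ m₂ (1 / (200 * m₁)) (1 / (100 * m₁)) (a k)).indicator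
        (fun _ => ENNReal.ofReal (coeff p₀ ψ (a k) ^ p₀)) ξ ∂(lerayMeasure m₁ m₂) := by
    refine lintegral_mono_ae ?_
    filter_upwards [ae_arg_ne (m₁ := m₁) (m₂ := m₂) a] with ξ hξ
    rcases testFun_cases (m₁ := m₁) (m₂ := m₂) (γ₁ := 1 / (200 * m₁)) (γ₂ := 1 / (100 * m₁))
      (p₀ := p₀) (ψ := ψ) ha.pos ha.halving hξ with ⟨h1, -⟩ | ⟨k, h1, h2, -⟩
    · rw [testFun', h1, norm_zero, zero_rpow (hq0 ξ).ne', ENNReal.ofReal_zero]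
      exact zero_le
    · refine le_trans ?_ (ENNReal.le_tsum k)
      rw [testFun', h2, indicator_of_mem h1, Complex.norm_real,
        norm_of_nonneg (by linarith [hone k])]
      exact ENNReal.ofReal_le_ofReal (rpow_le_rpow_of_exponent_le (hone k) (hq k ξ h1))
  refine hle.trans_lt ?_
  rw [lintegral_tsum fun k => (measurable_const.indicator (measurableSet_patch ..)).aemeasurable]
  have hterm : ∀ k, ∫⁻ ξ, (patch m₁ m₂ (1 / (200 * m₁)) (1 / (100 * m₁)) (a k)).indicator
        (fun _ => ENNReal.ofReal (coeff p₀ ψ (a k) ^ p₀)) ξ ∂(lerayMeasure m₁ m₂)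
      ≤ ENNReal.ofReal (m₂ * π / 2400 * (1 / 4) ^ k) := by
    intro k
    rw [lintegral_indicator_const (measurableSet_patch ..),
      lerayMeasure_patch hm₁ hm₂ (ha.pos k) (by linarith [ha.lt k]),
      ← ENNReal.ofReal_mul (by have := hone k; positivity)]
    refine ENNReal.ofReal_le_ofReal ?_
    have h := coeff_rpow_mul_sq_le hp0 (ha.pos k) (by linarith [hpos k]) (ha.decay k)
    have hc : 0 ≤ m₂ * π / 2400 := by have := pi_pos; positivity
    calc _ = m₂ * π / 2400 * (coeff p₀ ψ (a k) ^ p₀ * a k ^ 2) := by ring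
      _ ≤ _ := mul_le_mul_of_nonneg_left h hc
  refine (ENNReal.tsum_le_tsum hterm).trans_lt ?_
  rw [← ENNReal.ofReal_tsum_of_nonneg]
  · exact ENNReal.ofReal_lt_top
  · intro k; have := pi_pos; positivity
  · exact (summable_geometric_of_lt_one (by norm_num) (by norm_num)).mul_left _

lemma arg_mem_Icc (z : ℂ) : z.arg ∈ Icc (-π) π := ⟨(Complex.neg_pi_lt_arg z).le, Complex.arg_le_pi z⟩

lemma one_lt_exponent (hP : Profile p₀ ψ) (ξ : ℂ × ℂ) : 1 < exponent p₀ ψ ξ := by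
  have := hP.lower _ (arg_mem_Icc ξ.2)
  rw [exponent]; linarith

/-- One estimate serves twice: with exponent `1` for integrability and with `p` for the modular. The
latter applies because the patches lie in `-δ ≤ θ₂ < 0`, where `p < p₀`. -/
lemma memLpVar_testFun (hm₁ : 1 ≤ m₁) (hm₂ : 1 ≤ m₂) (hP : Profile p₀ ψ)
    (ha : Admissible p₀ ψ α₀ a) (hα₀ : α₀ ≤ 1 / 200) (hδ : 2 * α₀ ≤ δ)
    (hmono : MonotoneOn ψ (Icc 0 δ)) (hneg : ∀ t ∈ Ico (-δ) 0, ψ t < 0) :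
    MemLpVar m₁ m₂ (exponent p₀ ψ) (testFun' m₁ m₂ p₀ ψ a) := by
  have hpos : ∀ k, 0 ≤ ψ (a k) := fun k =>
    nonneg_of_monotoneOn hP hmono ⟨(ha.pos k).le, by linarith [ha.pos k, ha.lt k]⟩
  refine ⟨⟨measurable_testFun.aestronglyMeasurable, ?_⟩, 1, one_pos, ?_⟩
  · have h := lintegral_testFun_rpow_lt_top hm₁ hm₂ hP ha hα₀ hpos (q := fun _ => 1)
      (fun _ => one_pos) (fun _ _ _ => hP.one_lt.le)
    simpa [HasFiniteIntegral, ofReal_norm] using h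
  · simp only [modular, Complex.ofReal_one, one_mul]
    refine lintegral_testFun_rpow_lt_top hm₁ hm₂ hP ha hα₀ hpos
      (fun ξ => one_pos.trans (one_lt_exponent hP ξ)) fun k ξ hξ => ?_
    have := hneg ξ.2.arg ⟨by linarith [hξ.2.2.1.1, ha.lt k], by linarith [hξ.2.2.1.2, ha.pos k]⟩
    rw [exponent]; linarith

lemma eventually_testFun_eq_zero (ha : ∀ k, 0 < a k) {γ₁ γ₂ : ℝ} {z : ℂ × ℂ}
    (hz0 : 0 < z.2.arg) (hzπ : z.2.arg < π) :
    ∀ᶠ ξ in 𝓝[bdry m₁ m₂] z, testFun m₁ m₂ γ₁ γ₂ p₀ ψ a ξ = 0 := by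
  have t := tendsto_arg_comp ((continuous_snd.tendsto z).mono_left
    (nhdsWithin_le_nhds : 𝓝[bdry m₁ m₂] z ≤ 𝓝 z)) hz0.ne' hzπ.ne
  filter_upwards [t.eventually (lt_mem_nhds hz0)] with ξ hξ
  exact testFun_eq_zero ha hξ

/-- On the opposite patches the image of the test function is bounded below. -/
lemma le_norm_cauchyLF_testFun (hm₁ : 1 ≤ m₁) (hm₂ : 1 ≤ m₂)
    (ha : ∀ k, 0 < a k) (hh : ∀ k, 2 * a (k + 1) ≤ a k) (hlt : ∀ k, a k ≤ 1 / 200)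
    (hint : Integrable (testFun' m₁ m₂ p₀ ψ a) (lerayMeasure m₁ m₂)) (k : ℕ) {z : ℂ × ℂ}
    (hz : z ∈ oppositePatch m₁ m₂ (a k)) :
    1 / (4 * π ^ 2) * (π / (9600000 * m₂)) * coeff p₀ ψ (a k)
      ≤ ‖cauchyLF m₁ m₂ (testFun' m₁ m₂ p₀ ψ a) z‖ := by
  have : Fact (1 ≤ m₁) := ⟨hm₁⟩
  have : Fact (1 ≤ m₂) := ⟨hm₂⟩
  obtain ⟨hzb, -, hza, hz1⟩ := hz
  have hak := ha k
  have hI := integrable_div_w_sq hm₁ hm₂ hint hzb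
    (eventually_testFun_eq_zero ha (by linarith [hza.1])
      (by linarith [hza.2, hlt k, pi_gt_three]))
  have hker : ∀ j, ∀ ξ ∈ patch m₁ m₂ (1 / (200 * m₁)) (1 / (100 * m₁)) (a j),
      1 / (1000 * (m₂ * (a k + a j)) ^ 2) ≤ -(1 / (w m₁ m₂ ξ z) ^ 2).re := by
    intro j ξ hξ
    obtain ⟨b1, b2, b3⟩ := w_bounds hm₁ hm₂ hak (ha j) (hlt k) (hlt j) hξ.1 hzb hξ.2.2.1
      (Ioo_subset_Icc_self hza) hξ.2.2.2.2 hz1.2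
    exact le_neg_one_div_sq_re (mul_pos (by linarith) (by linarith [ha j])) b1 b2 b3
  have hre : ∀ c : ℝ, ∀ ξ, -((c : ℂ) / (w m₁ m₂ ξ z) ^ 2).re
      = c * -(1 / (w m₁ m₂ ξ z) ^ 2).re := by
    intro c ξ
    rw [div_eq_mul_one_div, Complex.re_ofReal_mul]; ring
  set A : ℝ := coeff p₀ ψ (a k) * (1 / (1000 * (m₂ * (a k + a k)) ^ 2)) with hA
  have hc0 : ∀ j, 0 ≤ coeff p₀ ψ (a j) := fun j => rpow_nonneg (ha j).le _
  -- The integrand `-Re(h/w²)` is nonnegative on every patch, so discarding all but the `k`-th only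
  -- lowers the integral.
  have hmono : ∫ ξ, (patch m₁ m₂ (1 / (200 * m₁)) (1 / (100 * m₁)) (a k)).indicator
      (fun _ => A) ξ ∂(lerayMeasure m₁ m₂)
      ≤ ∫ ξ, -(testFun' m₁ m₂ p₀ ψ a ξ / (w m₁ m₂ ξ z) ^ 2).re ∂(lerayMeasure m₁ m₂) := by
    refine integral_mono_ae ((integrable_const A).indicator (measurableSet_patch ..))
      hI.re.neg ?_
    filter_upwards [ae_arg_ne (m₁ := m₁) (m₂ := m₂) a] with ξ hξ
    rcases testFun_cases (m₁ := m₁) (m₂ := m₂) (γ₁ := 1 / (200 * m₁)) (γ₂ := 1 / (100 * m₁))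
      (p₀ := p₀) (ψ := ψ) ha hh hξ with ⟨h1, h2⟩ | ⟨j, h1, h2, h3⟩
    · rw [indicator_of_notMem (h2 k), testFun', h1]; simp
    · rw [testFun', h2, hre]
      by_cases hjk : k = j
      · subst hjk
        rw [indicator_of_mem h1]
        exact mul_le_mul_of_nonneg_left (hker k ξ h1) (hc0 k)
      · rw [indicator_of_notMem (h3 k hjk)]
        exact mul_nonneg (hc0 j) (le_trans (by positivity) (hker j ξ h1))
  have hre_int : ∫ ξ, (testFun' m₁ m₂ p₀ ψ a ξ / (w m₁ m₂ ξ z) ^ 2).re ∂(lerayMeasure m₁ m₂)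
      = (∫ ξ, testFun' m₁ m₂ p₀ ψ a ξ / (w m₁ m₂ ξ z) ^ 2 ∂(lerayMeasure m₁ m₂)).re :=
    integral_re hI
  rw [integral_indicator_const _ (measurableSet_patch ..), integral_neg, hre_int, Measure.real,
    lerayMeasure_patch hm₁ hm₂ hak (hlt k), ENNReal.toReal_ofReal (by have := pi_pos; positivity),
    smul_eq_mul] at hmono
  -- The powers of `a k` cancel: area times kernel bound is independent of the scale.
  have hval : m₂ * π / 2400 * a k ^ 2 * A = π / (9600000 * m₂) * coeff p₀ ψ (a k) := by
    rw [hA]; field_simp; ring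
  rw [hval] at hmono
  have hnorm : ‖1 / (2 * (π : ℂ) * Complex.I) ^ 2‖ = 1 / (4 * π ^ 2) := by
    simp only [norm_div, norm_one, norm_pow, norm_mul, Complex.norm_ofNat, Complex.norm_real,
      Complex.norm_I, mul_one, norm_of_nonneg pi_pos.le]
    ring
  rw [cauchyLF, norm_mul, hnorm, mul_assoc]
  refine mul_le_mul_of_nonneg_left (hmono.trans ?_) (by positivity)
  exact (neg_le_abs _).trans (Complex.abs_re_le_norm _)

/-- The opposite patches are disjoint, and each contributes at least the same positive amount. -/
lemma modular_image_eq_top (hm₁ : 1 ≤ m₁) (hm₂ : 1 ≤ m₂) (hP : Profile p₀ ψ)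
    (ha : Admissible p₀ ψ α₀ a) (hα₀ : α₀ ≤ 1 / 200) (hδ : 2 * α₀ ≤ δ)
    (hmono : MonotoneOn ψ (Icc 0 δ))
    (hint : Integrable (testFun' m₁ m₂ p₀ ψ a) (lerayMeasure m₁ m₂)) {g : ℂ × ℂ → ℂ}
    (hg : IsImage m₁ m₂ (testFun' m₁ m₂ p₀ ψ a) g) {t : ℝ} (ht : 0 < t) :
    modular m₁ m₂ (exponent p₀ ψ) (fun ξ => (t : ℂ) * g ξ) = ⊤ := by
  have hlt : ∀ k, a k ≤ 1 / 200 := fun k => (ha.lt k).le.trans hα₀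
  have hap := ha.pos
  have hp0 := hP.one_lt
  set c : ℝ := 1 / (4 * π ^ 2) * (π / (9600000 * m₂)) with hc
  have hc0 : 0 < c := by have := pi_pos; positivity
  -- Capping at `1` makes `s ^ p` at least `s ^ M`, where `M` bounds `p` on `0 ≤ θ₂ ≤ δ`; the factor
  -- lost is then the same for all patches.
  set s : ℝ := min (t * c) 1 with hs
  have hs0 : 0 < s := lt_min (mul_pos ht hc0) one_pos
  have hs1 : s ≤ 1 := min_le_right _ _
  set M : ℝ := p₀ + ψ δ with hM
  have hmeas : ∀ k, MeasurableSet (oppositePatch m₁ m₂ (a k)) := fun k =>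
    measurableSet_box _ _ measurableSet_Ioc measurableSet_Ioo measurableSet_Icc
  have hdisj : Pairwise (Function.onFun Disjoint fun k => oppositePatch m₁ m₂ (a k)) := by
    have key : ∀ j k : ℕ, j < k →
        Disjoint (oppositePatch m₁ m₂ (a j)) (oppositePatch m₁ m₂ (a k)) := by
      intro j k hjk
      rw [disjoint_left]
      intro ξ h1 h2
      linarith [h1.2.2.1.1, h2.2.2.1.2, two_mul_le_of_lt hap ha.halving hjk]
    intro j k hjk
    rcases lt_or_gt_of_ne hjk with h | h
    · exact key j k h
    · exact (key k j h).symm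
  have hlow : ∀ k, ENNReal.ofReal (s ^ M * (m₂ * π / 100)) ≤
      ∫⁻ ξ in oppositePatch m₁ m₂ (a k), ENNReal.ofReal (‖(t : ℂ) * g ξ‖ ^ exponent p₀ ψ ξ)
        ∂(lerayMeasure m₁ m₂) := by
    intro k
    have hψ : 0 ≤ ψ (a k) :=
      nonneg_of_monotoneOn hP hmono ⟨(hap k).le, by linarith [hap k, ha.lt k]⟩
    have hpk : 0 < p₀ + ψ (a k) := by linarith
    have hone := one_le_coeff (hap k) (by linarith [hlt k]) hpk
    have hae : ∀ᵐ ξ ∂((lerayMeasure m₁ m₂).restrict (oppositePatch m₁ m₂ (a k))),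
        ENNReal.ofReal (s ^ M * (a k ^ 2)⁻¹)
          ≤ ENNReal.ofReal (‖(t : ℂ) * g ξ‖ ^ exponent p₀ ψ ξ) := by
      filter_upwards [ae_restrict_mem (hmeas k), ae_restrict_of_ae hg] with ξ hξ hξg
      have hξa := hξ.2.2.1
      have hlim := tendsto_cauchyLF_of_eventually_eq_zero hm₁ hm₂ hint hξ.1
        (eventually_testFun_eq_zero hap (by linarith [hξa.1, hap k])
          (by linarith [hξa.2, hlt k, pi_gt_three]))
      -- The test function vanishes near `ξ`, so its image there is the integral evaluated at the
      -- boundary point itself.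
      have hgξ := tendsto_nhds_unique hξg hlim
      have hbound := le_norm_cauchyLF_testFun hm₁ hm₂ hap ha.halving hlt hint k hξ
      rw [← hgξ, ← hc] at hbound
      have hargδ : ξ.2.arg ∈ Icc 0 δ :=
        ⟨by linarith [hξa.1, hap k], by linarith [hξa.2, ha.lt k]⟩
      have hδ0 : 0 ≤ δ := hargδ.1.trans hargδ.2
      have he1 : p₀ + ψ (a k) ≤ exponent p₀ ψ ξ := by
        have := hmono ⟨(hap k).le, by linarith [hξa.1, hargδ.2]⟩ hargδ hξa.1.le
        rw [exponent]; linarith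
      have he2 : exponent p₀ ψ ξ ≤ M := by
        have := hmono hargδ ⟨hδ0, le_rfl⟩ hargδ.2
        rw [exponent]; linarith
      have hn : s * coeff p₀ ψ (a k) ≤ ‖(t : ℂ) * g ξ‖ := by
        rw [norm_mul, Complex.norm_real, norm_of_nonneg ht.le]
        calc s * coeff p₀ ψ (a k) ≤ t * c * coeff p₀ ψ (a k) :=
              mul_le_mul_of_nonneg_right (min_le_left _ _) (by linarith)
          _ = t * (c * coeff p₀ ψ (a k)) := by ring
          _ ≤ _ := by gcongr
      refine ENNReal.ofReal_le_ofReal ?_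
      have he0 : 0 ≤ exponent p₀ ψ ξ := by linarith
      calc s ^ M * (a k ^ 2)⁻¹ = s ^ M * coeff p₀ ψ (a k) ^ (p₀ + ψ (a k)) := by
            rw [coeff_rpow (hap k) hpk]
        _ ≤ s ^ exponent p₀ ψ ξ * coeff p₀ ψ (a k) ^ exponent p₀ ψ ξ := by
            refine mul_le_mul (rpow_le_rpow_of_exponent_ge hs0 hs1 he2)
              (rpow_le_rpow_of_exponent_le hone he1) (by positivity) (by positivity)
        _ = (s * coeff p₀ ψ (a k)) ^ exponent p₀ ψ ξ :=
            (mul_rpow hs0.le (by linarith)).symm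
        _ ≤ _ := rpow_le_rpow (mul_nonneg hs0.le (by linarith)) hn he0
    refine le_trans (le_of_eq ?_) (lintegral_mono_ae hae)
    rw [setLIntegral_const, lerayMeasure_oppositePatch hm₁ hm₂ (hap k) (hlt k),
      ← ENNReal.ofReal_mul (by positivity)]
    congr 1
    have := (hap k).ne'
    field_simp
  rw [modular, eq_top_iff]
  calc (⊤ : ENNReal) = ∑' _ : ℕ, ENNReal.ofReal (s ^ M * (m₂ * π / 100)) := by
        refine (ENNReal.tsum_const_eq_top_of_ne_zero ?_).symm
        rw [ne_eq, ENNReal.ofReal_eq_zero, not_le]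
        have := pi_pos
        positivity
    _ ≤ ∑' k, ∫⁻ ξ in oppositePatch m₁ m₂ (a k),
          ENNReal.ofReal (‖(t : ℂ) * g ξ‖ ^ exponent p₀ ψ ξ) ∂(lerayMeasure m₁ m₂) :=
        ENNReal.tsum_le_tsum hlow
    _ = ∫⁻ ξ in ⋃ k, oppositePatch m₁ m₂ (a k),
          ENNReal.ofReal (‖(t : ℂ) * g ξ‖ ^ exponent p₀ ψ ξ) ∂(lerayMeasure m₁ m₂) :=
        (lintegral_iUnion hmeas hdisj _).symm
    _ ≤ _ := setLIntegral_le_lintegral _ _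

end

variable {m₁ m₂ p₀ δ : ℝ} {ψ : ℝ → ℝ}

/-! ### Existence of admissible sequences -/

/-- The quantity is `exp(-ψ(α) ln(1/α) / (p₀ (p₀ + ψ(α))))`. Monotonicity replaces the denominator
by the constant `p₀ (p₀ + ψ(δ))`, and the growth hypothesis finishes. -/
lemma tendsto_decay (hP : Profile p₀ ψ) (hδ : 0 < δ) (hmono : MonotoneOn ψ (Icc 0 δ)) :
    Tendsto (fun α : ℝ => (1 / α) ^ (1 / (p₀ + ψ α) - 1 / p₀)) (𝓝[>] 0) (𝓝 0) := by
  have hp0 : 0 < p₀ := by linarith [hP.one_lt]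
  have hψδ := nonneg_of_monotoneOn hP hmono (t := δ) ⟨hδ.le, le_rfl⟩
  have hM : 0 < p₀ * (p₀ + ψ δ) := by positivity
  have hlim : Tendsto (fun α : ℝ => exp (-(1 / (p₀ * (p₀ + ψ δ)) * (ψ α * log (1 / α)))))
      (𝓝[>] 0) (𝓝 0) :=
    tendsto_exp_neg_atTop_nhds_zero.comp (hP.lim.const_mul_atTop (by positivity))
  have hmem : ∀ᶠ α : ℝ in 𝓝[>] 0, α ∈ Ioo 0 (min δ 1) :=
    Ioo_mem_nhdsGT (lt_min hδ one_pos)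
  refine squeeze_zero' ?_ ?_ hlim
  · filter_upwards [hmem] with α hα
    have := hα.1
    positivity
  · filter_upwards [hmem] with α hα
    have h0 := hα.1
    have h1 : α < δ := hα.2.trans_le (min_le_left _ _)
    have h2 : α < 1 := hα.2.trans_le (min_le_right _ _)
    have hψ := nonneg_of_monotoneOn hP hmono (t := α) ⟨h0.le, h1.le⟩
    have hψ' := hmono ⟨h0.le, h1.le⟩ ⟨hδ.le, le_rfl⟩ h1.le
    have hlog : 0 ≤ log (1 / α) := log_nonneg (by rw [le_div_iff₀ h0]; linarith)
    have hpα : 0 < p₀ + ψ α := by linarith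
    rw [rpow_def_of_pos (by positivity)]
    refine exp_le_exp.2 ?_
    have e : 1 / (p₀ + ψ α) - 1 / p₀ = -(ψ α / (p₀ * (p₀ + ψ α))) := by field_simp; ring
    have e2 : ψ α / (p₀ * (p₀ + ψ δ)) ≤ ψ α / (p₀ * (p₀ + ψ α)) := by gcongr
    rw [e]
    have := mul_le_mul_of_nonneg_right e2 hlog
    calc _ = -(ψ α / (p₀ * (p₀ + ψ α)) * log (1 / α)) := by ring
      _ ≤ -(ψ α / (p₀ * (p₀ + ψ δ)) * log (1 / α)) := neg_le_neg this
      _ = _ := by ring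

lemma exists_admissible (hP : Profile p₀ ψ) (hδ : 0 < δ) (hmono : MonotoneOn ψ (Icc 0 δ))
    {α₀ : ℝ} (hα₀ : 0 < α₀) : ∃ a : ℕ → ℝ, Admissible p₀ ψ α₀ a := by
  have h : ∀ k : ℕ, ∃ η : ℝ, 0 < η ∧ ∀ α ∈ Ioo 0 η,
      (1 / α) ^ (1 / (p₀ + ψ α) - 1 / p₀) ≤ (2 : ℝ) ^ (-((k : ℝ) + 1) / p₀) := by
    intro k
    have h1 : (0 : ℝ) < (2 : ℝ) ^ (-((k : ℝ) + 1) / p₀) := by positivity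
    have h2 := (tendsto_decay hP hδ hmono).eventually (gt_mem_nhds h1)
    obtain ⟨η, hη, h3⟩ := mem_nhdsGT_iff_exists_Ioo_subset.1 h2
    exact ⟨η, hη, fun α hα => (h3 hα).le⟩
  choose η hη hdec using h
  -- The term `x / 2` gives halving, `η (n + 1) / 2` gives the decay condition, and `α₀` need only
  -- enter the first term.
  let a : ℕ → ℝ := fun k => Nat.rec (min (η 0) α₀ / 2) (fun n x => min (x / 2) (η (n + 1) / 2)) k
  have a0 : a 0 = min (η 0) α₀ / 2 := rfl
  have as : ∀ n, a (n + 1) = min (a n / 2) (η (n + 1) / 2) := fun _ => rfl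
  have hpos : ∀ k, 0 < a k := by
    intro k
    induction k with
    | zero => rw [a0]; have := lt_min (hη 0) hα₀; positivity
    | succ n ih => rw [as]; have := hη (n + 1); exact lt_min (by positivity) (by positivity)
  have hhalf : ∀ k, 2 * a (k + 1) ≤ a k := fun k => by
    rw [as]; linarith [min_le_left (a k / 2) (η (k + 1) / 2)]
  refine ⟨a, hpos, fun k => ?_, hhalf, fun k => hdec k _ ⟨hpos k, ?_⟩⟩
  · have : a k ≤ a 0 := by
      rcases Nat.eq_zero_or_pos k with rfl | hk
      · exact le_rfl
      · linarith [two_mul_le_of_lt hpos hhalf hk, hpos k]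
    linarith [min_le_right (η 0) α₀]
  · cases k with
    | zero => rw [a0]; linarith [min_le_left (η 0) α₀, lt_min (hη 0) hα₀, hη 0]
    | succ n => rw [as]; linarith [min_le_right (a n / 2) (η (n + 1) / 2), hη (n + 1)]

/-! ### The log-Hölder condition -/

lemma norm_fst_le_edist₂ (z z' : ℂ × ℂ) : ‖z.1 - z'.1‖ ≤ edist₂ z z' :=
  Real.le_sqrt_of_sq_le (by linarith [sq_nonneg ‖z.2 - z'.2‖])

lemma norm_snd_le_edist₂ (z z' : ℂ × ℂ) : ‖z.2 - z'.2‖ ≤ edist₂ z z' :=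
  Real.le_sqrt_of_sq_le (by linarith [sq_nonneg ‖z.1 - z'.1‖])

lemma edist₂_le_add (z z' : ℂ × ℂ) : edist₂ z z' ≤ ‖z.1 - z'.1‖ + ‖z.2 - z'.2‖ := by
  rw [edist₂, Real.sqrt_le_left (by positivity)]
  nlinarith [norm_nonneg (z.1 - z'.1), norm_nonneg (z.2 - z'.2)]

/-- Rotating `ξ₂` by a small `α > 0` moves the point by at most `α` but changes `p` by `ψ(α)`, and
`ψ(α) ln(1/α)` exceeds every constant. -/
lemma not_logHolderNear (hP : Profile p₀ ψ) {ξ : ℂ × ℂ}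
    (hξ : ξ ∈ bdry m₁ m₂) (h0 : ξ.2 ≠ 0) (harg : ξ.2.arg = 0) (hm₂ : 1 ≤ m₂) :
    ¬ LogHolderNear m₁ m₂ (exponent p₀ ψ) ξ := by
  rintro ⟨C, δ, hδ, hH⟩
  have h1 := hP.lim.eventually_gt_atTop (max C 0)
  have h2 : ∀ᶠ α : ℝ in 𝓝[>] 0, α ∈ Ioo 0 (min δ 1) := Ioo_mem_nhdsGT (lt_min hδ one_pos)
  obtain ⟨α, hα1, hα2⟩ := (h1.and h2).exists
  have hα0 := hα2.1
  have hαδ : α < δ := hα2.2.trans_le (min_le_left _ _)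
  have hα1' : α < 1 := hα2.2.trans_le (min_le_right _ _)
  have hξ2 : ξ.2 = (‖ξ.2‖ : ℂ) := by
    conv_lhs => rw [← Complex.norm_mul_exp_arg_mul_I ξ.2, harg]
    simp
  set z' : ℂ × ℂ := (ξ.1, ξ.2 * Complex.exp (α * Complex.I)) with hz'
  have hz'b : z' ∈ bdry m₁ m₂ := by
    have hξ' : ‖ξ.1‖ ^ (2 * m₁) + ‖ξ.2‖ ^ (2 * m₂) = 1 := hξ
    rw [bdry, mem_ofPred_eq, hz']
    simpa [Complex.norm_exp_ofReal_mul_I] using hξ'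
  have hargz : z'.2.arg = α := by
    rw [hz', Complex.exp_mul_I]
    simp only
    rw [hξ2]
    exact Complex.arg_mul_cos_add_sin_mul_I (norm_pos_iff.2 h0)
      ⟨by linarith [pi_pos], by linarith [pi_gt_three]⟩
  have hle1 : ‖ξ.2‖ ≤ 1 := by
    refine le_one_of_rpow_le_one hm₂ ?_
    rw [bdry_norm_snd hξ]
    have : 0 ≤ ‖ξ.1‖ ^ (2 * m₁) := by positivity
    linarith
  have hd2 : ‖z'.2 - ξ.2‖ ≤ α := by
    have e : z'.2 - ξ.2 = ξ.2 * (Complex.exp (Complex.I * α) - 1) := by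
      rw [hz', mul_comm Complex.I]; ring
    rw [e, norm_mul]
    have := Real.norm_exp_I_mul_ofReal_sub_one_le (x := α)
    rw [norm_of_nonneg hα0.le] at this
    nlinarith [norm_nonneg (Complex.exp (Complex.I * α) - 1), norm_nonneg ξ.2]
  have hd : edist₂ z' ξ ≤ α := by
    refine (edist₂_le_add _ _).trans ?_
    have : z'.1 - ξ.1 = 0 := sub_self _
    rw [this, norm_zero, zero_add]; exact hd2
  have hself : edist₂ ξ ξ < δ := by simpa [edist₂] using hδ
  have key := hH z' hz'b ξ hξ (hd.trans_lt hαδ) hself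
  rw [exponent, exponent, hargz, harg, hP.zero, add_zero, add_sub_cancel_left] at key
  have hψ : ψ α ≤ C / |log (edist₂ z' ξ)| := (le_abs_self _).trans key
  have hlog : 0 < log (1 / α) := log_pos (by rw [lt_div_iff₀ hα0]; linarith)
  have hnn : 0 ≤ edist₂ z' ξ := Real.sqrt_nonneg _
  -- At distance zero the conventions `log 0 = 0` and `C / 0 = 0` turn the bound into `ψ α ≤ 0`,
  -- which is already contradictory.
  rcases hnn.eq_or_lt with hd0 | hd0
  · rw [← hd0, log_zero, abs_zero, div_zero] at hψ
    have := mul_nonpos_of_nonpos_of_nonneg hψ hlog.le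
    linarith [le_max_right C 0]
  · have hl : log (1 / α) ≤ |log (edist₂ z' ξ)| := by
      rw [one_div, log_inv]
      exact (neg_le_neg (log_le_log hd0 hd)).trans (neg_le_abs _)
    rw [le_div_iff₀ (hlog.trans_le hl)] at hψ
    have hψ0 : 0 < ψ α := by
      by_contra! hc
      have := mul_nonpos_of_nonpos_of_nonneg hc hlog.le
      linarith [le_max_right C 0]
    have := mul_le_mul_of_nonneg_left hl hψ0.le
    linarith [le_max_left C 0]

/-- The arguments of two points outside a disc around `0` are close modulo `2π`. -/
lemma abs_arg_sub_arg_le {κ : ℝ} (hκ : 0 < κ) {u v : ℂ} (hu : κ ≤ ‖u‖) (hv : κ ≤ ‖v‖) :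
    |u.arg - v.arg| ≤ π / (2 * κ) * ‖u - v‖ ∨
      2 * π - |u.arg - v.arg| ≤ π / (2 * κ) * ‖u - v‖ := by
  have hsq : ‖u - v‖ ^ 2 = ‖u‖ ^ 2 + ‖v‖ ^ 2 - 2 * (‖u‖ * ‖v‖ * cos (u.arg - v.arg)) := by
    rw [← star_mul_re v u |>.trans (by ring : ‖v‖ * ‖u‖ * _ = ‖u‖ * ‖v‖ * _)]
    simp only [← Complex.normSq_eq_norm_sq, Complex.normSq_apply, Complex.sub_re,
      Complex.sub_im, Complex.mul_re, Complex.star_def, Complex.conj_re, Complex.conj_im]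
    ring
  have hlow : 2 * κ ^ 2 * (1 - cos (u.arg - v.arg)) ≤ ‖u - v‖ ^ 2 := by
    have h1 : 0 ≤ 1 - cos (u.arg - v.arg) := by linarith [cos_le_one (u.arg - v.arg)]
    have h2 : κ * κ ≤ ‖u‖ * ‖v‖ := mul_le_mul hu hv hκ.le (norm_nonneg _)
    have h3 := mul_le_mul_of_nonneg_right h2 h1
    nlinarith [sq_nonneg (‖u‖ - ‖v‖)]
  have key : ∀ D : ℝ, 0 ≤ D → D ≤ π → cos D = cos (u.arg - v.arg) →
      D ≤ π / (2 * κ) * ‖u - v‖ := by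
    intro D h0 h1 h2
    -- The bound `1 - cos D ≥ 2D²/π²` on `[0, π]` turns the law of cosines into a linear estimate
    -- for the angle.
    have h3 := cos_le_one_sub_mul_cos_sq (abs_le.2 ⟨by linarith, h1⟩ : |D| ≤ π)
    rw [← h2] at hlow
    have h4 : (2 * κ / π * D) ^ 2 ≤ ‖u - v‖ ^ 2 := by
      have := mul_le_mul_of_nonneg_left h3 (by positivity : 0 ≤ 2 * κ ^ 2)
      calc (2 * κ / π * D) ^ 2 = 2 * κ ^ 2 * (2 / π ^ 2 * D ^ 2) := by field_simp
        _ ≤ _ := by linarith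
    have h5 := abs_le_of_sq_le_sq' h4 (norm_nonneg _)
    have h6 : D = π / (2 * κ) * (2 * κ / π * D) := by
      have := pi_pos.ne'; field_simp
    rw [h6]
    exact mul_le_mul_of_nonneg_left h5.2 (by have := pi_pos; positivity)
  by_cases h : |u.arg - v.arg| ≤ π
  · exact Or.inl (key _ (abs_nonneg _) h (cos_abs _))
  · push Not at h
    have h1 : |u.arg - v.arg| ≤ 2 * π := by
      rw [abs_le]
      constructor <;> linarith [(arg_mem_Icc u).1, (arg_mem_Icc u).2, (arg_mem_Icc v).1,
        (arg_mem_Icc v).2]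
    refine Or.inr (key _ (by linarith) (by linarith) ?_)
    rw [cos_two_pi_sub, cos_abs]

/-- If `d L² < 1`, then `log x ≤ log L + log d ≤ (log d)/2`, so a Lipschitz change of distance costs
only a factor `2`. -/
lemma div_abs_log_le {C L x d : ℝ} (hL : 1 ≤ L) (hx : 0 ≤ x) (hd : 0 ≤ d) (hxd : x ≤ L * d)
    (hd1 : d * L ^ 2 < 1) : C / |log x| ≤ 2 * |C| / |log d| := by
  rcases hx.eq_or_lt with rfl | hx0
  · rw [log_zero, abs_zero, div_zero]; positivity
  · have hd0 : 0 < d := by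
      by_contra! hc
      have : d = 0 := le_antisymm hc hd
      rw [this, mul_zero] at hxd
      linarith
    have hL0 : 0 < L := by linarith
    have hlogL : 0 ≤ log L := log_nonneg hL
    have hlogd : log d + 2 * log L < 0 := by
      have := log_neg (by positivity) hd1
      rwa [log_mul hd0.ne' (by positivity), log_pow] at this
    have hlogx : log x ≤ log L + log d := by
      rw [← log_mul hL0.ne' hd0.ne']; exact log_le_log hx0 hxd
    rw [abs_of_neg (by linarith : log x < 0), abs_of_neg (by linarith : log d < 0)]
    calc C / -log x ≤ |C| / -log x := by
          have : 0 ≤ -log x := by linarith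
          gcongr
          exact le_abs_self C
      _ = 2 * |C| / (2 * -log x) := by rw [mul_div_mul_left _ _ two_ne_zero]
      _ ≤ 2 * |C| / -log d := by
          have : 0 < -log d := by linarith
          gcongr
          linarith

/-- The log-Hölder regularity of `ψ` away from `0` passes to `ψ ∘ arg`. -/
lemma logHolderNear_of_real (hψπ : ψ (-π) = ψ π)
    (hH : ∀ s ∈ Icc (-π) π, s ≠ 0 → LogHolderNearReal ψ s) {ξ : ℂ × ℂ}
    (h0 : ξ.2 ≠ 0) (harg : ξ.2.arg ≠ 0) :
    LogHolderNear m₁ m₂ (exponent p₀ ψ) ξ := by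
  set s := ξ.2.arg with hs
  have hsm : s ∈ Icc (-π) π := arg_mem_Icc _
  have hsgt : -π < s := Complex.neg_pi_lt_arg _
  obtain ⟨C₁, δ₁, hδ₁, H₁⟩ := hH s hsm harg
  -- Needed when `s = π`: points near `ξ` may then have argument near `-π`.
  obtain ⟨C₂, δ₂, hδ₂, H₂⟩ := hH (-π) ⟨le_rfl, by linarith [pi_pos]⟩ (by linarith [pi_pos])
  set κ := ‖ξ.2‖ / 2 with hκ
  have hκ0 : 0 < κ := by have := norm_pos_iff.2 h0; positivity
  set L := max 1 (π / (2 * κ)) with hL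
  have hL1 : 1 ≤ L := le_max_left _ _
  have hL0 : 0 < L := by linarith
  have hang : ∀ u v : ℂ, κ ≤ ‖u‖ → κ ≤ ‖v‖ → |u.arg - v.arg| ≤ L * ‖u - v‖ ∨
      2 * π - |u.arg - v.arg| ≤ L * ‖u - v‖ := by
    intro u v hu hv
    have : π / (2 * κ) * ‖u - v‖ ≤ L * ‖u - v‖ :=
      mul_le_mul_of_nonneg_right (le_max_right _ _) (norm_nonneg _)
    exact (abs_arg_sub_arg_le hκ0 hu hv).imp (fun h => h.trans this) fun h => h.trans this
  -- Off the branch cut, `η ≤ π - |s|` excludes the wrapped alternative, since `2π - |u - s| ≥ π -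
  -- |s|`.
  obtain ⟨η, hη0, hη1, hη2, hη3, hη4⟩ : ∃ η : ℝ, 0 < η ∧ η ≤ δ₁ ∧ η ≤ δ₂ ∧ η ≤ 1 / 2 ∧
      (s ≠ π → η ≤ π - |s|) := by
    by_cases hsπ : s = π
    · exact ⟨min (min δ₁ δ₂) (1 / 2), by positivity, (min_le_left _ _).trans (min_le_left _ _),
        (min_le_left _ _).trans (min_le_right _ _), min_le_right _ _, fun h => absurd hsπ h⟩
    · have : |s| < π := abs_lt.2 ⟨hsgt, lt_of_le_of_ne hsm.2 hsπ⟩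
      have : 0 < π - |s| := by linarith
      exact ⟨min (min (min δ₁ δ₂) (1 / 2)) (π - |s|), by positivity,
        (min_le_left _ _).trans ((min_le_left _ _).trans (min_le_left _ _)),
        (min_le_left _ _).trans ((min_le_left _ _).trans (min_le_right _ _)),
        (min_le_left _ _).trans (min_le_right _ _), fun _ => min_le_right _ _⟩
  have hδ0 : 0 < min κ (η / (5 * L ^ 2)) := by positivity
  refine ⟨2 * |C₁| + 2 * |C₂|, min κ (η / (5 * L ^ 2)), hδ0, fun z _ z' _ hz hz' => ?_⟩
  have hnear : ∀ z : ℂ × ℂ, edist₂ z ξ < min κ (η / (5 * L ^ 2)) →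
      κ ≤ ‖z.2‖ ∧ L * ‖z.2 - ξ.2‖ < η ∧ ‖z.1 - ξ.1‖ * (5 * L ^ 2) < η ∧
        ‖z.2 - ξ.2‖ * (5 * L ^ 2) < η := by
    intro z hz
    have h1 := (norm_snd_le_edist₂ z ξ).trans_lt hz
    have h2 := h1.trans_le (min_le_left _ _)
    have h3 := h1.trans_le (min_le_right _ _)
    have h4 := ((norm_fst_le_edist₂ z ξ).trans_lt hz).trans_le (min_le_right _ _)
    rw [lt_div_iff₀ (by positivity)] at h3 h4
    refine ⟨?_, ?_, h4, h3⟩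
    · have := norm_sub_norm_le ξ.2 z.2
      rw [norm_sub_rev] at this
      linarith
    · have : L ≤ 5 * L ^ 2 := by nlinarith
      have := mul_le_mul_of_nonneg_right this (norm_nonneg (z.2 - ξ.2))
      linarith
  have hκξ : κ ≤ ‖ξ.2‖ := by linarith
  obtain ⟨a1, a2, a3, a4⟩ := hnear z hz
  obtain ⟨b1, b2, b3, b4⟩ := hnear z' hz'
  have hd0 : 0 ≤ edist₂ z z' := Real.sqrt_nonneg _
  -- The distance is at most a sum of four terms, each below `η/(5L²)`, and `η ≤ 1/2`.
  have hd1 : edist₂ z z' * L ^ 2 < 1 := by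
    have h1 := edist₂_le_add z z'
    have h2 : ‖z.1 - z'.1‖ ≤ ‖z.1 - ξ.1‖ + ‖z'.1 - ξ.1‖ := by
      rw [norm_sub_rev z'.1]; exact norm_sub_le_norm_sub_add_norm_sub _ _ _
    have h3 : ‖z.2 - z'.2‖ ≤ ‖z.2 - ξ.2‖ + ‖z'.2 - ξ.2‖ := by
      rw [norm_sub_rev z'.2]; exact norm_sub_le_norm_sub_add_norm_sub _ _ _
    have h4 := mul_le_mul_of_nonneg_right (h1.trans (add_le_add h2 h3)) (sq_nonneg L)
    nlinarith
  have hd2 : L * ‖z.2 - z'.2‖ ≤ L * edist₂ z z' :=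
    mul_le_mul_of_nonneg_left (norm_snd_le_edist₂ z z') hL0.le
  have hd3 : L * edist₂ z z' < 1 := by nlinarith
  have hpair := hang z.2 z'.2 a1 b1
  have hza := hang z.2 ξ.2 a1 hκξ
  have hzb := hang z'.2 ξ.2 b1 hκξ
  have tm := arg_mem_Icc z.2
  have tm' := arg_mem_Icc z'.2
  rw [exponent, exponent, add_sub_add_left_eq_sub]
  rw [← hs] at hza hzb
  set t := z.2.arg
  set t' := z'.2.arg
  set d := edist₂ z z'
  have hpi := pi_gt_three
  have hK₁ : 0 ≤ 2 * |C₁| / |log d| := by positivity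
  have hK₂ : 0 ≤ 2 * |C₂| / |log d| := by positivity
  rw [add_div]
  have near₁ : ∀ u v : ℝ, u ∈ Icc (-π) π → v ∈ Icc (-π) π → |u - s| < η → |v - s| < η →
      |u - v| ≤ L * d → |ψ u - ψ v| ≤ 2 * |C₁| / |log d| := fun u v hu hv h1 h2 h3 =>
    (H₁ u hu v hv (h1.trans_le hη1) (h2.trans_le hη1)).trans
      (div_abs_log_le hL1 (abs_nonneg _) hd0 h3 hd1)
  have near₂ : ∀ u v : ℝ, u ∈ Icc (-π) π → v ∈ Icc (-π) π → |u - -π| < η → |v - -π| < η →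
      |u - v| ≤ L * d → |ψ u - ψ v| ≤ 2 * |C₂| / |log d| := fun u v hu hv h1 h2 h3 =>
    (H₂ u hu v hv (h1.trans_le hη2) (h2.trans_le hη2)).trans
      (div_abs_log_le hL1 (abs_nonneg _) hd0 h3 hd1)
  have close : |t - t'| ≤ 1 → |t - t'| ≤ L * d := by
    intro h
    rcases hpair with h1 | h1
    · exact h1.trans hd2
    · linarith
  by_cases hsπ : s = π
  · have side : ∀ u ∈ Icc (-π) π, ∀ e : ℝ, e < η → (|u - s| ≤ e ∨ 2 * π - |u - s| ≤ e) →
        |u - s| < η ∨ |u - -π| < η := by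
      intro u hu e he h
      refine h.imp (fun h => h.trans_lt he) fun h => ?_
      rw [hsπ, abs_of_nonpos (by linarith [hu.2])] at h
      rw [abs_of_nonneg (by linarith [hu.1])]
      linarith
    -- Across the cut the wrapped distance splits as `(π - u) + (v + π)`; each piece is estimated at
    -- its own end, and `ψ(-π) = ψ(π)` joins them.
    have cross : ∀ u v : ℝ, u ∈ Icc (-π) π → v ∈ Icc (-π) π → |u - s| < η → |v - -π| < η →
        (|u - v| ≤ L * d ∨ 2 * π - |u - v| ≤ L * d) →
        |ψ u - ψ v| ≤ 2 * |C₁| / |log d| + 2 * |C₂| / |log d| := by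
      intro u v hu hv h1 h2 h3
      have h1' := abs_lt.1 h1
      have h2' := abs_lt.1 h2
      rw [hsπ] at h1'
      have h4 : |u - v| = u - v := abs_of_nonneg (by linarith [h1'.1, h2'.2])
      rw [h4] at h3
      have h5 : 2 * π - (u - v) ≤ L * d := by
        rcases h3 with h3 | h3
        · linarith [h1'.1, h2'.2]
        · exact h3
      have e1 := near₁ u s hu hsm h1 (by rw [sub_self, abs_zero]; exact hη0) (by
        rw [hsπ, abs_of_nonpos (by linarith [hu.2])]; linarith [hv.1])
      have e2 := near₂ (-π) v ⟨le_rfl, by linarith⟩ hv (by rw [sub_self, abs_zero]; exact hη0) h2 (by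
        rw [abs_of_nonpos (by linarith [hv.1])]; linarith [hu.2])
      calc |ψ u - ψ v| = |(ψ u - ψ s) + (ψ (-π) - ψ v)| := by rw [hsπ, hψπ]; congr 1; ring
        _ ≤ _ := (abs_add_le _ _).trans (add_le_add e1 e2)
    have hpair' : |t - t'| ≤ L * d ∨ 2 * π - |t - t'| ≤ L * d :=
      hpair.imp (fun h => h.trans hd2) fun h => h.trans hd2
    rcases side t tm _ a2 hza with h1 | h1 <;> rcases side t' tm' _ b2 hzb with h2 | h2
    · have : |t - t'| ≤ 1 := by
        rw [abs_lt] at h1 h2; rw [abs_le]; constructor <;> linarith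
      linarith [near₁ t t' tm tm' h1 h2 (close this)]
    · exact cross t t' tm tm' h1 h2 hpair'
    · rw [abs_sub_comm]
      exact cross t' t tm' tm h2 h1 (by rwa [abs_sub_comm t' t])
    · have : |t - t'| ≤ 1 := by
        rw [abs_lt] at h1 h2; rw [abs_le]; constructor <;> linarith
      linarith [near₂ t t' tm tm' h1 h2 (close this)]
  · have hηs := hη4 hsπ
    have side : ∀ u ∈ Icc (-π) π, ∀ e : ℝ, e < η → (|u - s| ≤ e ∨ 2 * π - |u - s| ≤ e) →
        |u - s| < η := by
      intro u hu e he h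
      rcases h with h | h
      · exact h.trans_lt he
      · have h1 : |u - s| ≤ |u| + |s| := abs_sub _ _
        have h2 : |u| ≤ π := abs_le.2 hu
        linarith
    have h1 := side t tm _ a2 hza
    have h2 := side t' tm' _ b2 hzb
    have : |t - t'| ≤ 1 := by
      rw [abs_lt] at h1 h2; rw [abs_le]; constructor <;> linarith
    linarith [near₁ t t' tm tm' h1 h2 (close this)]

end CLF

end

theorem theorem2 (m₁ m₂ : ℝ) (hm₁ : 1 ≤ m₁) (hm₂ : 1 ≤ m₂) :
    ∃ γ₁ γ₂ : ℝ, 0 < γ₁ ∧ γ₁ < γ₂ ∧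
      ∀ (p₀ : ℝ) (ψ : ℝ → ℝ), CLF.Profile p₀ ψ →
        (∃ α₀ : ℝ, 0 < α₀ ∧
          (∃ a : ℕ → ℝ, CLF.Admissible p₀ ψ α₀ a) ∧
          ∀ a : ℕ → ℝ, CLF.Admissible p₀ ψ α₀ a →
            CLF.MemLpVar m₁ m₂ (CLF.exponent p₀ ψ) (CLF.testFun m₁ m₂ γ₁ γ₂ p₀ ψ a) ∧
            (∃ g : ℂ × ℂ → ℂ, CLF.IsImage m₁ m₂ (CLF.testFun m₁ m₂ γ₁ γ₂ p₀ ψ a) g) ∧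
            ∀ g : ℂ × ℂ → ℂ, CLF.IsImage m₁ m₂ (CLF.testFun m₁ m₂ γ₁ γ₂ p₀ ψ a) g →
              (∀ t : ℝ, 0 < t →
                CLF.modular m₁ m₂ (CLF.exponent p₀ ψ) (fun ξ => (t : ℂ) * g ξ) = ⊤) ∧
              ¬ CLF.MemLpVar m₁ m₂ (CLF.exponent p₀ ψ) g) ∧
        ¬ CLF.BoundedOnLpVar m₁ m₂ (CLF.exponent p₀ ψ) ∧
        (∀ ξ ∈ CLF.bdry m₁ m₂, ξ.2 ≠ 0 → Complex.arg ξ.2 = 0 →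
          ¬ CLF.LogHolderNear m₁ m₂ (CLF.exponent p₀ ψ) ξ) ∧
        (ψ (-Real.pi) = ψ Real.pi →
          (∀ s ∈ Set.Icc (-Real.pi) Real.pi, s ≠ 0 → CLF.LogHolderNearReal ψ s) →
          ∀ ξ ∈ CLF.bdry m₁ m₂, ξ.2 ≠ 0 → Complex.arg ξ.2 ≠ 0 →
            CLF.LogHolderNear m₁ m₂ (CLF.exponent p₀ ψ) ξ) := by
  refine ⟨1 / (200 * m₁), 1 / (100 * m₁), by positivity,
    one_div_lt_one_div_of_lt (by positivity) (by linarith), fun p₀ ψ hP => ?_⟩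
  obtain ⟨δ, hδ, -, hmono, hneg⟩ := hP.near
  -- The first bound is required by the kernel estimate; the second keeps the angles `±2α` inside
  -- `[-δ, δ]`.
  have hα₀ : 0 < min (1 / 200) (δ / 2) := by positivity
  have hle : 2 * min (1 / 200) (δ / 2) ≤ δ := by linarith [min_le_right (1 / 200) (δ / 2)]
  have hmem : ∀ a : ℕ → ℝ, CLF.Admissible p₀ ψ (min (1 / 200) (δ / 2)) a →
      CLF.MemLpVar m₁ m₂ (CLF.exponent p₀ ψ) (CLF.testFun' m₁ m₂ p₀ ψ a) := fun a ha =>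
    CLF.memLpVar_testFun hm₁ hm₂ hP ha (min_le_left _ _) hle hmono hneg
  have himage : ∀ a : ℕ → ℝ, CLF.Admissible p₀ ψ (min (1 / 200) (δ / 2)) a →
      ∃ g, CLF.IsImage m₁ m₂ (CLF.testFun' m₁ m₂ p₀ ψ a) g := fun a ha =>
    CLF.exists_isImage_testFun hm₁ hm₂ ha.pos ha.halving (hmem a ha).1
  have htop : ∀ a : ℕ → ℝ, CLF.Admissible p₀ ψ (min (1 / 200) (δ / 2)) a → ∀ g,
      CLF.IsImage m₁ m₂ (CLF.testFun' m₁ m₂ p₀ ψ a) g → ∀ t : ℝ, 0 < t →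
        CLF.modular m₁ m₂ (CLF.exponent p₀ ψ) (fun ξ => (t : ℂ) * g ξ) = ⊤ :=
    fun a ha g hg t ht => CLF.modular_image_eq_top hm₁ hm₂ hP ha (min_le_left _ _) hle hmono
      (hmem a ha).1 hg ht
  have hnot : ∀ a : ℕ → ℝ, CLF.Admissible p₀ ψ (min (1 / 200) (δ / 2)) a → ∀ g,
      CLF.IsImage m₁ m₂ (CLF.testFun' m₁ m₂ p₀ ψ a) g →
        ¬ CLF.MemLpVar m₁ m₂ (CLF.exponent p₀ ψ) g := by
    rintro a ha g hg ⟨-, t, ht, hlt⟩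
    exact hlt.ne (htop a ha g hg t ht)
  have hexists := CLF.exists_admissible hP hδ hmono hα₀
  refine ⟨⟨_, hα₀, hexists, fun a ha => ⟨hmem a ha, himage a ha, fun g hg =>
    ⟨htop a ha g hg, hnot a ha g hg⟩⟩⟩, ?_, ?_, ?_⟩
  -- Boundedness already fails because one image leaves the space; the constant plays no role.
  · rintro ⟨C, hC⟩
    obtain ⟨a, ha⟩ := hexists
    obtain ⟨g, hg⟩ := himage a ha
    exact hnot a ha g hg (hC _ g (hmem a ha) hg).1
  · exact fun ξ hξ h0 harg => CLF.not_logHolderNear hP hξ h0 harg hm₂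
  · exact fun hψπ hH ξ _ h0 harg => CLF.logHolderNear_of_real hψπ hH h0 harg
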